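/- Let $\Bbbk\in\{\mathbb R,\mathbb C\}$, let $X$ be an arbitrary topological space, and let $\pi:\mathcal E\to X$ be an (F) Banach bundle over $\Bbbk$: $\pi$ is a continuous open map whose fibers $\mathcal E_x=\pi^{-1}(x)$ are Banach spaces over $\Bbbk$; scalar multiplication $\Bbbk\times\mathcal E\to\mathcal E$, fiberwise addition $\mathcal E\times_X\mathcal E\to\mathcal E$ and the norm $\mathcal E\to\mathbb R_{\ge 0}$ are continuous; and for every $x\in X$ the sets $\{p\in\mathcal E : \pi(p)\in U,\ \|p\|<\varepsilon\}$ ($U$ a neighborhood of $x$, $\varepsilon>0$) form a neighborhood basis of $0_x$ in $\mathcal E$. Assume that the bundle is $n$-homogeneous (every fiber has dimension $n$ over $\Bbbk$) and weakly full (for all $x\in X$, $p\in\mathcal E_x$, $\varepsilon>0$ there is a continuous section $s$ on a neighborhood of $x$ with $\|s(x)-p\|<\varepsilon$). Let $\mathcal K^n(\mathcal E)$ be the set of vertical full-dimensional convex bodies, that is, of the compact (real-)convex subsets of $\mathcal E$ contained in a single fiber and having non-empty interior in it. Equip it with the Vietoris topology, generated by the sets $\{K : K\subseteq U\}$ and $\{K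 : K\cap U\neq\emptyset\}$ with $U\subseteq\mathcal E$ open. For $\mathbb K=\mathbb R$ or $\mathbb K=\Bbbk$, a $\mathbb K$-ellipsoid in a fiber is the image of the closed Euclidean unit ball of $\mathbb K^d$, $d=\dim_{\mathbb K}\mathcal E_x$, under an invertible $\mathbb K$-affine map $\mathbb K^d\to\mathcal E_x$. A Löwner (John) $\mathbb K$-ellipsoid of a body $K\subset\mathcal E_x$ is a $\mathbb K$-ellipsoid of minimal (maximal) volume among those in $\mathcal E_x$ that contain $K$ (are contained in $K$). Then: 1. Every $K\in\mathcal K^n(\mathcal E)$ has a unique Löwner $\mathbb R$-ellipsoid $K^L(K)$ and a unique John $\mathbb R$-ellipsoid $K_J(K)$, and the maps $K\mapsto K^L(K)$ and $K\mapsto K_J(K)$ from $\mathcal K^n(\mathcal E)$ to itself are continuous. 2. Every $K\in\mathcal K^n(\mathcal E)$ has a unique Löwner $\Bbbk$-ellipsoid, and the map sending $K$ to it is continuous from $\mathcal K^n(\mathcal E)$ to itself. 3. Every $K\in\mathcal K^n(\mathcal E)$ has a John $\Bbbk$-ellipsoid. It is unique whenever some translate of $K$ within its fiber is balanced (stable under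 multiplication by all $\lambda\in\Bbbk$ with $|\lambda|\le 1$). On the subspace of those $K\in\mathcal K^n(\mathcal E)$ whose John $\Bbbk$-ellipsoid is unique, the map sending $K$ to its John $\Bbbk$-ellipsoid is continuous into $\mathcal K^n(\mathcal E)$. -/

import Mathlib

open Set Filter Topology MeasureTheory Bundle

/-- The total space of a family of fibres `E x`, `x : X` (the disjoint union of the fibres, with
no topology chosen in advance). The model fibre of `Bundle.TotalSpace` is a phantom parameter. -/
abbrev Tot {X : Type*} (E : X → Type*) := Bundle.TotalSpace Unit E

/-- Banach bundles over `X` with scalar field `𝕜`: `Tot E` carries a topology for which the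
projection is continuous and open, the fibres are Banach spaces, scalar multiplication and
fibrewise addition `E ×_X E → E` are continuous, and the tubes
`{p | π p ∈ U, ‖p‖ < ε}` form a neighbourhood basis at every zero vector. -/
structure IsBanachBundle (𝕜 : Type*) [RCLike 𝕜] {X : Type*} [TopologicalSpace X]
    (E : X → Type*) [∀ x, NormedAddCommGroup (E x)] [∀ x, NormedSpace 𝕜 (E x)]
    [TopologicalSpace (Tot E)] : Prop where
  complete : ∀ x, CompleteSpace (E x)
  continuous_proj : Continuous (fun p : Tot E => p.proj)
  isOpenMap_proj : IsOpenMap (fun p : Tot E => p.proj)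
  continuous_smul :
    Continuous (fun q : 𝕜 × Tot E => (⟨q.2.proj, q.1 • q.2.snd⟩ : Tot E))
  /- `TotalSpace (Unit × Unit) (E ×ᵇ E)` is the fibre product, topologized as a subspace of the
  product `Tot E × Tot E`. -/
  continuous_add :
    Continuous (fun q : Bundle.TotalSpace (Unit × Unit) (E ×ᵇ E) =>
      (⟨q.proj, q.snd.1 + q.snd.2⟩ : Tot E))
  nhds_zero : ∀ x : X, (𝓝 (⟨x, 0⟩ : Tot E)).HasBasis
    (fun Uε : Set X × ℝ => Uε.1 ∈ 𝓝 x ∧ 0 < Uε.2)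
    (fun Uε => {p : Tot E | p.proj ∈ Uε.1 ∧ ‖p.snd‖ < Uε.2})

/-- (F) Banach bundles: Banach bundles whose norm is continuous on the total space. -/
structure IsFBanachBundle (𝕜 : Type*) [RCLike 𝕜] {X : Type*} [TopologicalSpace X]
    (E : X → Type*) [∀ x, NormedAddCommGroup (E x)] [∀ x, NormedSpace 𝕜 (E x)]
    [TopologicalSpace (Tot E)] : Prop extends IsBanachBundle 𝕜 E where
  continuous_norm : Continuous (fun p : Tot E => ‖p.snd‖)

/-- All fibres are `n`-dimensional over `𝕜`. -/
def IsHomogeneous (𝕜 : Type*) [RCLike 𝕜] {X : Type*} (E : X → Type*)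
    [∀ x, NormedAddCommGroup (E x)] [∀ x, NormedSpace 𝕜 (E x)] (n : ℕ) : Prop :=
  ∀ x, FiniteDimensional 𝕜 (E x) ∧ Module.finrank 𝕜 (E x) = n

/-- Approximately (weakly) full bundles: every `p ∈ E x` is approximated in norm by the values
at `x` of continuous sections defined on neighbourhoods of `x`. (A section on `U` is given by a
family of vectors whose values off `U` are irrelevant.) -/
def IsWeaklyFull {X : Type*} [TopologicalSpace X] (E : X → Type*)
    [∀ x, NormedAddCommGroup (E x)] [TopologicalSpace (Tot E)] : Prop :=
  ∀ (x : X) (p : E x) (ε : ℝ), 0 < ε → ∃ U ∈ 𝓝 x, ∃ s : ∀ y, E y,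
    ContinuousOn (fun y => (⟨y, s y⟩ : Tot E)) U ∧ ‖s x - p‖ < ε

/-- Full-dimensional convex bodies in a real normed space: non-empty compact convex sets with
non-empty interior. -/
abbrev SolidBody (V : Type*) [NormedAddCommGroup V] [NormedSpace ℝ V] :=
  {K : ConvexBody V // (interior (K : Set V)).Nonempty}

/-- `𝕂`-ellipsoids: images of the closed Euclidean unit ball of `𝕂ᵈ`, `d = dim_𝕂 V`, under
invertible `𝕂`-affine maps `𝕂ᵈ → V`. -/
def IsEllipsoid (𝕂 : Type*) [RCLike 𝕂] {V : Type*} [NormedAddCommGroup V] [NormedSpace 𝕂 V]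
    (S : Set V) : Prop :=
  ∃ (L : EuclideanSpace 𝕂 (Fin (Module.finrank 𝕂 V)) ≃ₗ[𝕂] V) (c : V),
    S = (fun u => c + L u) '' Metric.closedBall 0 1

/-- `S` has at most the volume of `T`. Volume on a finite-dimensional space is Haar (Lebesgue)
measure, which exists and is unique up to a positive factor, so that the comparison does not
depend on the choice. -/
def VolLE {V : Type*} [NormedAddCommGroup V] (S T : Set V) : Prop :=
  letI : MeasurableSpace V := borel V
  ∀ μ : Measure V, μ.IsAddHaarMeasure → μ S ≤ μ T

/-- `L` is a Löwner `𝕂`-ellipsoid of `K`: a `𝕂`-ellipsoid containing `K`, of least volume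
among these. -/
def IsLoewner (𝕂 : Type*) [RCLike 𝕂] {V : Type*} [NormedAddCommGroup V] [NormedSpace ℝ V]
    [NormedSpace 𝕂 V] (K L : SolidBody V) : Prop :=
  IsEllipsoid 𝕂 (L.1 : Set V) ∧ (K.1 : Set V) ⊆ L.1 ∧
    ∀ T : Set V, IsEllipsoid 𝕂 T → (K.1 : Set V) ⊆ T → VolLE (L.1 : Set V) T

/-- `J` is a John `𝕂`-ellipsoid of `K`: a `𝕂`-ellipsoid contained in `K`, of largest volume
among these. -/
def IsJohn (𝕂 : Type*) [RCLike 𝕂] {V : Type*} [NormedAddCommGroup V] [NormedSpace ℝ V]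
    [NormedSpace 𝕂 V] (K J : SolidBody V) : Prop :=
  IsEllipsoid 𝕂 (J.1 : Set V) ∧ (J.1 : Set V) ⊆ K.1 ∧
    ∀ T : Set V, IsEllipsoid 𝕂 T → T ⊆ (K.1 : Set V) → VolLE T (J.1 : Set V)

/-- Vertical full-dimensional convex bodies: a point of the base and a full-dimensional convex
body in the fibre over it. -/
structure VerticalBody {X : Type*} (E : X → Type*) [∀ x, NormedAddCommGroup (E x)]
    [∀ x, NormedSpace ℝ (E x)] where
  base : X
  body : SolidBody (E base)

/-- A vertical body as a subset of the total space. -/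
def VerticalBody.toSet {X : Type*} {E : X → Type*} [∀ x, NormedAddCommGroup (E x)]
    [∀ x, NormedSpace ℝ (E x)] (K : VerticalBody E) : Set (Tot E) :=
  (fun v : E K.base => (⟨K.base, v⟩ : Tot E)) '' (K.body.1 : Set (E K.base))

/-- The Vietoris topology on vertical bodies: the subspace topology from the Vietoris topology
on the subsets of the total space. -/
instance VerticalBody.instTopologicalSpace {X : Type*} {E : X → Type*}
    [∀ x, NormedAddCommGroup (E x)] [∀ x, NormedSpace ℝ (E x)] [TopologicalSpace (Tot E)] :
    TopologicalSpace (VerticalBody E) :=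
  TopologicalSpace.induced VerticalBody.toSet (TopologicalSpace.vietoris (Tot E))

/-- The self-map of the set of vertical bodies given by a self-map of the set of bodies of
each fibre. -/
def verticalMap {X : Type*} {E : X → Type*} [∀ x, NormedAddCommGroup (E x)]
    [∀ x, NormedSpace ℝ (E x)] (g : ∀ x, SolidBody (E x) → SolidBody (E x)) :
    VerticalBody E → VerticalBody E :=
  fun K => ⟨K.base, g K.base K.body⟩

/-! ### Singular values and strict log-concavity of the determinant -/

section LinearAlgebra

variable {𝕂 : Type*} [RCLike 𝕂]

/-! An ellipsoid is encoded by a linear map and a vector: either as the image of the unit ball under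
`u ↦ c + A u`, or as its preimage under `x ↦ A x - b`. In the first form the volume is proportional
to a fixed positive power of `‖det A‖`, in the second to the same power of its inverse. So John and
Löwner ellipsoids both come from maximizing `‖det A‖`, over the maps sending the ball into the body
and over the maps sending the body into the ball, respectively (`isJohn_iff`, `isLoewner_iff`).

Existence is compactness of the feasible set. For uniqueness, the admissible linear parts form a
convex set stable under unitaries on one side. By the singular value decomposition and the
inequality between arithmetic and geometric means, two maximizers differ by a unitary, so the
ellipsoids agree up to translation. For Löwner ellipsoids the parallelogram law then fixes the
centre. For John ellipsoids two real translates span a segment along which an ellipsoid can be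
elongated. Over `ℂ` the elongation needs a whole circle of translates, which a balanced body
provides and a general body does not; hence the restricted third statement.

Continuity is a maximum theorem: when the feasible sets vary well with the body
(`IsStableConstraint`), the set of maximizers is upper semicontinuous
(`IsStableConstraint.exists_maxDet_subset`). If all maximizers at one body describe the same
ellipsoid, every choice of maximizers is continuous there (`IsStableConstraint.exists_near`),
whether or not nearby bodies have unique solutions.

The bundle is reduced to the model fibre by a local frame (`IsFBanachBundle.exists_frame`). In such
a frame the Vietoris topology amounts to convergence of base points together with Hausdorff
convergence of the model bodies (`VerticalBody.eventually_near`, `VerticalBody.tendsto_of_near`). -/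

open scoped ComplexOrder in
/-- The singular value decomposition of an invertible matrix. -/
theorem Matrix.exists_eq_unitary_mul_diagonal_mul_unitary {m : Type*} [Fintype m] [DecidableEq m]
    (M : Matrix m m 𝕂) (hM : IsUnit M) :
    ∃ W ∈ Matrix.unitaryGroup m 𝕂, ∃ U ∈ Matrix.unitaryGroup m 𝕂, ∃ s : m → ℝ,
      (∀ i, 0 < s i) ∧ M = W * Matrix.diagonal (fun i => (s i : 𝕂)) * U := by
  classical
  -- With `M M* = W D W*`, the singular values are the square roots of the entries of `D`, and `U`
  -- is forced to be `D^(-1/2) W* M`.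
  have hN : (M * M.conjTranspose).PosDef :=
    Matrix.PosDef.mul_conjTranspose_self M (Matrix.vecMul_injective_of_isUnit hM)
  set W := hN.isHermitian.eigenvectorUnitary with hW
  set d := hN.isHermitian.eigenvalues with hd
  have hdpos : ∀ i, 0 < d i := hN.eigenvalues_pos
  have hspec : M * star M = (W : Matrix m m 𝕂) * Matrix.diagonal (fun i => (d i : 𝕂)) *
      star (W : Matrix m m 𝕂) := by
    have := hN.isHermitian.spectral_theorem
    rw [Unitary.conjStarAlgAut_apply] at this
    exact this
  have hspec' : star (W : Matrix m m 𝕂) * (M * star M) * W =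
      Matrix.diagonal (fun i => (d i : 𝕂)) := by
    have h1 : star (W : Matrix m m 𝕂) * W = 1 := Unitary.coe_star_mul_self W
    rw [hspec]
    calc _ = (star (W : Matrix m m 𝕂) * W) * Matrix.diagonal (fun i => (d i : 𝕂)) *
          (star (W : Matrix m m 𝕂) * W) := by noncomm_ring
      _ = _ := by rw [h1]; simp
  have hs : ∀ i, 0 < Real.sqrt (d i) := fun i => Real.sqrt_pos.2 (hdpos i)
  have hs' : ∀ i, ((Real.sqrt (d i) : ℝ) : 𝕂) ≠ 0 := fun i =>
    RCLike.ofReal_ne_zero.2 (hs i).ne'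
  refine ⟨W, W.2, Matrix.diagonal (fun i => ((Real.sqrt (d i) : ℝ) : 𝕂)⁻¹) *
    star (W : Matrix m m 𝕂) * M, ?_, fun i => Real.sqrt (d i), hs, ?_⟩
  · rw [Matrix.mem_unitaryGroup_iff]
    rw [star_mul, star_mul, star_star]
    calc _ = Matrix.diagonal (fun i => ((Real.sqrt (d i) : ℝ) : 𝕂)⁻¹) *
          (star (W : Matrix m m 𝕂) * (M * star M) * W) *
          star (Matrix.diagonal (fun i => ((Real.sqrt (d i) : ℝ) : 𝕂)⁻¹)) := by noncomm_ring
      _ = 1 := by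
        rw [hspec', Matrix.star_eq_conjTranspose, Matrix.diagonal_conjTranspose,
          Matrix.diagonal_mul_diagonal, Matrix.diagonal_mul_diagonal, ← Matrix.diagonal_one]
        congr 1
        funext i
        have : (d i : 𝕂) = ((Real.sqrt (d i) : ℝ) : 𝕂) * ((Real.sqrt (d i) : ℝ) : 𝕂) := by
          rw [← RCLike.ofReal_mul, Real.mul_self_sqrt (hdpos i).le]
        have h0 := hs' i
        simp only [Pi.star_apply, star_inv₀, RCLike.star_def, RCLike.conj_ofReal]
        rw [this]
        field_simp
  · have h1 : (W : Matrix m m 𝕂) * star (W : Matrix m m 𝕂) = 1 := Unitary.coe_mul_star_self W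
    have h2 : Matrix.diagonal (fun i => ((Real.sqrt (d i) : ℝ) : 𝕂)) *
        Matrix.diagonal (fun i => ((Real.sqrt (d i) : ℝ) : 𝕂)⁻¹) = 1 := by
      rw [Matrix.diagonal_mul_diagonal, ← Matrix.diagonal_one]
      congr 1
      funext i
      exact mul_inv_cancel₀ (hs' i)
    calc M = (W : Matrix m m 𝕂) * star (W : Matrix m m 𝕂) * M := by rw [h1, one_mul]
      _ = (W : Matrix m m 𝕂) * (Matrix.diagonal (fun i => ((Real.sqrt (d i) : ℝ) : 𝕂)) *
        Matrix.diagonal (fun i => ((Real.sqrt (d i) : ℝ) : 𝕂)⁻¹)) *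
          star (W : Matrix m m 𝕂) * M := by rw [h2, mul_one]
      _ = _ := by noncomm_ring

/-- Positive numbers with product `1` for which the product of the `(1 + sᵢ) / 2` is at most `1`
are all equal to `1`. -/
theorem eq_one_of_prod_half_one_add_le {m : Type*} [Fintype m] {s : m → ℝ}
    (hs : ∀ i, 0 < s i) (h1 : ∏ i, s i = 1) (h2 : ∏ i, (1 + s i) / 2 ≤ 1) : ∀ i, s i = 1 := by
  by_contra! h
  obtain ⟨j, hj⟩ := h
  -- Factorwise `s ≤ ((1 + s) / 2) ^ 2`, strictly when `s ≠ 1`; one strict factor contradicts the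
  -- two product bounds.
  have : ∏ i, s i < ∏ i, ((1 + s i) / 2) ^ 2 := by
    refine Finset.prod_lt_prod (fun i _ => hs i) (fun i _ => ?_) ⟨j, Finset.mem_univ j, ?_⟩
    · nlinarith [sq_nonneg (1 - s i)]
    · have : 0 < (s j - 1) ^ 2 := by
        have := sub_ne_zero.2 hj
        positivity
      nlinarith
  rw [h1, Finset.prod_pow] at this
  have h3 : 0 ≤ ∏ i, (1 + s i) / 2 := Finset.prod_nonneg fun i _ => by linarith [hs i]
  nlinarith

theorem Matrix.norm_det_of_mem_unitaryGroup {m : Type*} [Fintype m] [DecidableEq m]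
    {U : Matrix m m 𝕂} (hU : U ∈ Matrix.unitaryGroup m 𝕂) : ‖U.det‖ = 1 := by
  have := Matrix.det_of_mem_unitary hU
  exact CStarRing.norm_of_mem_unitary this

/-- Strict log-concavity of the determinant: in a convex set of matrices that is stable under
multiplication by unitary matrices from the right and on which the identity has the largest
determinant, all matrices of largest determinant are unitary. -/
theorem Matrix.mem_unitaryGroup_of_norm_det_eq_one {m : Type*} [Fintype m] [DecidableEq m]
    {G : Set (Matrix m m 𝕂)} (hconv : Convex ℝ G)
    (hU : ∀ M ∈ G, ∀ U ∈ Matrix.unitaryGroup m 𝕂, M * U ∈ G) (hone : 1 ∈ G)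
    (hmax : ∀ M ∈ G, ‖M.det‖ ≤ 1) {M : Matrix m m 𝕂} (hM : M ∈ G) (hdet : ‖M.det‖ = 1) :
    M ∈ Matrix.unitaryGroup m 𝕂 := by
  have hMu : IsUnit M := by
    rw [Matrix.isUnit_iff_isUnit_det, isUnit_iff_ne_zero]
    intro h
    simp [h] at hdet
  obtain ⟨W, hW, U, hUu, s, hs, rfl⟩ := Matrix.exists_eq_unitary_mul_diagonal_mul_unitary M hMu
  have hWG : W ∈ G := by simpa using hU 1 hone W hW
  have hWS : W * Matrix.diagonal (fun i => (s i : 𝕂)) ∈ G := by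
    have := hU _ hM _ (Unitary.star_mem hUu)
    rwa [mul_assoc, (Matrix.mem_unitaryGroup_iff).1 hUu, mul_one] at this
  -- Once the right unitary factor is stripped, the midpoint of `W` and `W S` has singular values
  -- `(1 + sᵢ) / 2`, and maximality bounds their product by `1`.
  have hmid := hconv hWG hWS (a := 1 / 2) (b := 1 / 2) (by norm_num) (by norm_num) (by norm_num)
  have heq : (1 / 2 : ℝ) • W + (1 / 2 : ℝ) • (W * Matrix.diagonal (fun i => (s i : 𝕂))) =
      W * Matrix.diagonal (fun i => (((1 + s i) / 2 : ℝ) : 𝕂)) := by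
    ext i j
    simp only [Matrix.add_apply, Matrix.smul_apply, Matrix.mul_diagonal, RCLike.real_smul_eq_coe_mul]
    push_cast
    ring
  rw [heq] at hmid
  have h2 := hmax _ hmid
  rw [Matrix.det_mul, norm_mul, Matrix.norm_det_of_mem_unitaryGroup hW, one_mul,
    Matrix.det_diagonal, norm_prod] at h2
  rw [Matrix.det_mul, Matrix.det_mul, norm_mul, norm_mul, Matrix.norm_det_of_mem_unitaryGroup hW,
    Matrix.norm_det_of_mem_unitaryGroup hUu, one_mul, mul_one, Matrix.det_diagonal,
    norm_prod] at hdet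
  simp only [RCLike.norm_ofReal] at h2 hdet
  have hs1 : ∀ i, s i = 1 := by
    refine eq_one_of_prod_half_one_add_le hs ?_ ?_
    · rw [← hdet]
      exact Finset.prod_congr rfl fun i _ => (abs_of_pos (hs i)).symm
    · refine le_trans (le_of_eq ?_) h2
      exact Finset.prod_congr rfl fun i _ => (abs_of_pos (by linarith [hs i])).symm
  have : Matrix.diagonal (fun i => (s i : 𝕂)) = 1 := by
    rw [← Matrix.diagonal_one]
    congr 1
    funext i
    simp [hs1 i]
  rw [this, mul_one]
  exact mul_mem hW hUu

variable {d : ℕ}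

theorem Matrix.det_toEuclideanCLM (M : Matrix (Fin d) (Fin d) 𝕂) :
    (Matrix.toEuclideanCLM (n := Fin d) (𝕜 := 𝕂) M).det = M.det := by
  rw [ContinuousLinearMap.det, Matrix.coe_toEuclideanCLM_eq_toEuclideanLin]
  exact LinearMap.det_toLpLin 2 M

/-- `Matrix.mem_unitaryGroup_of_norm_det_eq_one` for operators. -/
theorem mem_unitary_of_norm_det_eq_one
    {G : Set (EuclideanSpace 𝕂 (Fin d) →L[𝕂] EuclideanSpace 𝕂 (Fin d))} (hconv : Convex ℝ G)
    (hU : ∀ M ∈ G, ∀ U ∈ unitary (EuclideanSpace 𝕂 (Fin d) →L[𝕂] EuclideanSpace 𝕂 (Fin d)),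
      M * U ∈ G) (hone : 1 ∈ G) (hmax : ∀ M ∈ G, ‖M.det‖ ≤ 1)
    {M : EuclideanSpace 𝕂 (Fin d) →L[𝕂] EuclideanSpace 𝕂 (Fin d)} (hM : M ∈ G)
    (hdet : ‖M.det‖ = 1) :
    M ∈ unitary (EuclideanSpace 𝕂 (Fin d) →L[𝕂] EuclideanSpace 𝕂 (Fin d)) := by
  set T := Matrix.toEuclideanCLM (n := Fin d) (𝕜 := 𝕂) with hT
  obtain ⟨N, rfl⟩ := T.surjective M
  have hreal : ∀ (a : ℝ) (A : Matrix (Fin d) (Fin d) 𝕂), T (a • A) = a • T A := by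
    intro a A
    rw [RCLike.real_smul_eq_coe_smul (K := 𝕂) a A, RCLike.real_smul_eq_coe_smul (K := 𝕂) a (T A),
      map_smul]
  refine Unitary.map_mem T (r := N) ?_
  refine Matrix.mem_unitaryGroup_of_norm_det_eq_one (G := T ⁻¹' G) ?_ ?_ ?_ ?_ hM ?_
  · intro A hA B hB a b ha hb hab
    simp only [mem_preimage, map_add, hreal] at *
    exact hconv hA hB ha hb hab
  · intro A hA U hUu
    simp only [mem_preimage, map_mul] at *
    exact hU _ hA _ (Unitary.map_mem T hUu)
  · simpa using hone
  · intro A hA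
    rw [← Matrix.det_toEuclideanCLM]
    exact hmax _ hA
  · rw [← Matrix.det_toEuclideanCLM]
    exact hdet

/-- `mem_unitary_of_norm_det_eq_one` for multiplication from the left. -/
theorem mem_unitary_of_norm_det_eq_one_left
    {G : Set (EuclideanSpace 𝕂 (Fin d) →L[𝕂] EuclideanSpace 𝕂 (Fin d))} (hconv : Convex ℝ G)
    (hU : ∀ M ∈ G, ∀ U ∈ unitary (EuclideanSpace 𝕂 (Fin d) →L[𝕂] EuclideanSpace 𝕂 (Fin d)),
      U * M ∈ G) (hone : 1 ∈ G) (hmax : ∀ M ∈ G, ‖M.det‖ ≤ 1)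
    {M : EuclideanSpace 𝕂 (Fin d) →L[𝕂] EuclideanSpace 𝕂 (Fin d)} (hM : M ∈ G)
    (hdet : ‖M.det‖ = 1) :
    M ∈ unitary (EuclideanSpace 𝕂 (Fin d) →L[𝕂] EuclideanSpace 𝕂 (Fin d)) := by
  set T := Matrix.toEuclideanCLM (n := Fin d) (𝕜 := 𝕂) with hT
  obtain ⟨N, rfl⟩ := T.surjective M
  have hreal : ∀ (a : ℝ) (A : Matrix (Fin d) (Fin d) 𝕂), T (a • A) = a • T A := by
    intro a A
    rw [RCLike.real_smul_eq_coe_smul (K := 𝕂) a A, RCLike.real_smul_eq_coe_smul (K := 𝕂) a (T A),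
      map_smul]
  have hdetT : ∀ A : Matrix (Fin d) (Fin d) 𝕂, ‖(T A.conjTranspose).det‖ = ‖A.det‖ := by
    intro A
    rw [hT, Matrix.det_toEuclideanCLM, Matrix.det_conjTranspose, norm_star]
  -- Taking adjoints exchanges left and right multiplication and preserves the absolute value of the
  -- determinant.
  have hN : N.conjTranspose ∈ Matrix.unitaryGroup (Fin d) 𝕂 := by
    refine Matrix.mem_unitaryGroup_of_norm_det_eq_one (G := {A | T A.conjTranspose ∈ G})
      ?_ ?_ ?_ ?_ ?_ ?_
    · intro A hA B hB a b ha hb hab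
      simp only [mem_ofPred_eq, Matrix.conjTranspose_add, Matrix.conjTranspose_smul, star_trivial,
        map_add, hreal] at *
      exact hconv hA hB ha hb hab
    · intro A hA U hUu
      simp only [mem_ofPred_eq, Matrix.conjTranspose_mul, map_mul] at *
      exact hU _ hA _ (Unitary.map_mem T (Unitary.star_mem hUu))
    · simpa using hone
    · intro A hA
      rw [← hdetT]
      exact hmax _ hA
    · rw [mem_ofPred_eq, Matrix.conjTranspose_conjTranspose]
      exact hM
    · rw [Matrix.det_conjTranspose, norm_star, ← Matrix.det_toEuclideanCLM]
      exact hdet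
  refine Unitary.map_mem T (r := N) ?_
  rw [← Matrix.conjTranspose_conjTranspose N]
  exact Unitary.star_mem hN

end LinearAlgebra

/-! ### Hausdorff-close convex bodies -/

section Bodies

/-- Two sets each contained in the open `ε`-thickening of the other. -/
def Near {V : Type*} [PseudoMetricSpace V] (ε : ℝ) (C D : Set V) : Prop :=
  C ⊆ Metric.thickening ε D ∧ D ⊆ Metric.thickening ε C

theorem Near.mono {V : Type*} [PseudoMetricSpace V] {ε δ : ℝ} {C D : Set V} (h : Near ε C D)
    (hεδ : ε ≤ δ) : Near δ C D :=
  ⟨h.1.trans (Metric.thickening_mono hεδ _), h.2.trans (Metric.thickening_mono hεδ _)⟩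

theorem Near.refl {V : Type*} [PseudoMetricSpace V] {ε : ℝ} (hε : 0 < ε) (C : Set V) :
    Near ε C C :=
  ⟨Metric.self_subset_thickening hε C, Metric.self_subset_thickening hε C⟩

/-- Full-dimensional convex bodies, as sets. -/
structure IsSolidBody {V : Type*} [NormedAddCommGroup V] [NormedSpace ℝ V] (C : Set V) :
    Prop where
  convex : Convex ℝ C
  isCompact : IsCompact C
  interior_nonempty : (interior C).Nonempty

theorem IsSolidBody.exists_closedBall_subset {V : Type*} [NormedAddCommGroup V] [NormedSpace ℝ V]
    {C : Set V} (hC : IsSolidBody C) : ∃ p r, 0 < r ∧ Metric.closedBall p r ⊆ C := by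
  obtain ⟨p, hp⟩ := hC.interior_nonempty
  obtain ⟨r, hr, h⟩ := Metric.nhds_basis_closedBall.mem_iff.1 (mem_interior_iff_mem_nhds.1 hp)
  exact ⟨p, r, hr, h⟩

theorem IsSolidBody.exists_subset_closedBall {V : Type*} [NormedAddCommGroup V] [NormedSpace ℝ V]
    {C : Set V} (hC : IsSolidBody C) : ∃ R, 0 < R ∧ ∀ x ∈ C, ‖x‖ ≤ R := by
  obtain ⟨R, hR, h⟩ := hC.isCompact.isBounded.exists_pos_norm_le
  exact ⟨R, hR, h⟩

/-- If a closed convex set comes `ε`-close to every point of a ball of radius `r > ε`, then it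
contains the centre of the ball. -/
theorem Convex.mem_of_closedBall_subset_thickening {V : Type*} [NormedAddCommGroup V]
    [NormedSpace ℝ V] {D : Set V} (hD : Convex ℝ D) (hDc : IsClosed D) {y : V} {r ε : ℝ}
    (hr : 0 < r) (hε : ε < r) (h : Metric.closedBall y r ⊆ Metric.thickening ε D) : y ∈ D := by
  by_contra hy
  obtain ⟨f, u, hfu, huy⟩ := geometric_hahn_banach_closed_point hD hDc hy
  obtain ⟨a, ha, hya⟩ := Metric.mem_thickening_iff.1 (h (Metric.mem_closedBall_self hr.le))
  have hε0 : 0 < ε := dist_nonneg.trans_lt hya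
  have hf : 0 < ‖f‖ := by
    rw [norm_pos_iff]
    rintro rfl
    have := hfu a ha
    simp only [zero_apply] at this huy
    linarith
  have hlt : ε / r * ‖f‖ < ‖f‖ := by
    have : ε / r < 1 := (div_lt_one hr).2 hε
    nlinarith
  -- Moving from `y` by `r v` raises the separating functional by more than `ε ‖f‖`, so no point of
  -- `D` can be `ε`-close to `y + r v`.
  obtain ⟨v, hv, hfv⟩ : ∃ v, ‖v‖ < 1 ∧ ε / r * ‖f‖ < f v := by
    obtain ⟨v, hv, hfv⟩ := f.exists_lt_apply_of_lt_opNorm hlt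
    rcases abs_cases (f v) with ⟨h1, -⟩ | ⟨h1, -⟩
    · exact ⟨v, hv, by rwa [Real.norm_eq_abs, h1] at hfv⟩
    · exact ⟨-v, by rwa [norm_neg], by rwa [Real.norm_eq_abs, h1, ← map_neg] at hfv⟩
  have hz : y + r • v ∈ Metric.closedBall y r := by
    rw [mem_closedBall_iff_norm, add_sub_cancel_left, norm_smul, Real.norm_of_nonneg hr.le]
    nlinarith
  obtain ⟨b, hb, hzb⟩ := Metric.mem_thickening_iff.1 (h hz)
  have h1 : f (y + r • v) - f b ≤ ‖f‖ * ε := by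
    rw [← map_sub]
    refine (le_abs_self _).trans ((f.le_opNorm _).trans ?_)
    rw [dist_eq_norm] at hzb
    gcongr
  have h2 : ‖f‖ * ε < r * f v := by
    have := mul_lt_mul_of_pos_left hfv hr
    calc ‖f‖ * ε = r * (ε / r * ‖f‖) := by field_simp
      _ < _ := this
  have h3 := hfu b hb
  simp only [map_add, map_smul, smul_eq_mul] at h1
  linarith

/-- Shrinking a convex set towards the centre of a ball that it contains. -/
theorem Convex.closedBall_shrink_subset {V : Type*} [NormedAddCommGroup V] [NormedSpace ℝ V]
    {C : Set V} (hC : Convex ℝ C) {p y : V} {r s : ℝ} (h : Metric.closedBall p r ⊆ C)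
    (hy : y ∈ C) (hs0 : 0 ≤ s) (hs1 : s < 1) :
    Metric.closedBall (s • y + (1 - s) • p) ((1 - s) * r) ⊆ C := by
  intro z hz
  have hs : 0 < 1 - s := by linarith
  set w := z - (s • y + (1 - s) • p) with hw
  have hz' : z = s • y + (1 - s) • (p + (1 - s)⁻¹ • w) := by
    rw [smul_add, smul_smul, mul_inv_cancel₀ hs.ne', one_smul, hw]
    abel
  rw [hz']
  refine hC hy (h ?_) hs0 hs.le (by ring)
  rw [mem_closedBall_iff_norm] at hz ⊢
  rw [add_sub_cancel_left, norm_smul, norm_inv, Real.norm_of_nonneg hs.le,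
    inv_mul_le_iff₀ hs]
  exact hz

/-- Each point of the half ball is the centre of a ball of radius `r / 2` inside `D`, hence inside
the thickening of `C`. This gives an inner radius common to all bodies near `D`. -/
theorem Near.closedBall_subset {V : Type*} [NormedAddCommGroup V] [NormedSpace ℝ V]
    {C D : Set V} {p : V} {r ε : ℝ} (h : Near ε C D) (hC : Convex ℝ C) (hCc : IsClosed C)
    (hε : ε < r / 2) (hr : 0 < r) (hD : Metric.closedBall p r ⊆ D) :
    Metric.closedBall p (r / 2) ⊆ C := by
  intro y hy
  refine hC.mem_of_closedBall_subset_thickening hCc (half_pos hr) hε ?_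
  refine Subset.trans ?_ h.2
  refine Subset.trans (Metric.closedBall_subset_closedBall' ?_) hD
  rw [Metric.mem_closedBall] at hy
  linarith

end Bodies

/-! ### Determinant maximization and its stability -/

section MaxDet

/-- The Euclidean space `𝕂ᵈ`. -/
abbrev Euc (𝕂 : Type*) [RCLike 𝕂] (d : ℕ) := EuclideanSpace 𝕂 (Fin d)

/-- Pairs of a linear endomorphism of `𝕂ᵈ` and a vector, the parameters of ellipsoids. -/
abbrev EllParam (𝕂 : Type*) [RCLike 𝕂] (d : ℕ) := (Euc 𝕂 d →L[𝕂] Euc 𝕂 d) × Euc 𝕂 d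

variable {𝕂 : Type*} [RCLike 𝕂] {d : ℕ}

/-- The elements of largest determinant. -/
def maxDet (F : Set (EllParam 𝕂 d)) : Set (EllParam 𝕂 d) :=
  {q ∈ F | ∀ q' ∈ F, ‖q'.1.det‖ ≤ ‖q.1.det‖}

/-- Constraints on the parameters of ellipsoids, depending on a convex body, for which the
problem of maximizing the determinant is well-posed. -/
structure IsStableConstraint (F : Set (Euc 𝕂 d) → Set (EllParam 𝕂 d)) : Prop where
  bounded : ∀ D, IsSolidBody D → ∃ R ε, 0 < ε ∧ ∀ C, IsSolidBody C → Near ε C D →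
    F C ⊆ Metric.closedBall 0 R
  closed : ∀ D, IsSolidBody D → ∀ q ∉ F D, ∃ N ∈ 𝓝 q, ∃ ε > 0, ∀ C, IsSolidBody C → Near ε C D →
    Disjoint N (F C)
  lower : ∀ D, IsSolidBody D → ∀ q ∈ F D, ∀ m < ‖q.1.det‖, ∃ ε > 0, ∀ C, IsSolidBody C →
    Near ε C D → ∃ q' ∈ F C, m < ‖q'.1.det‖
  nondegenerate : ∀ D, IsSolidBody D → ∃ q ∈ F D, q.1.det ≠ 0

theorem continuous_norm_det : Continuous fun q : EllParam 𝕂 d => ‖q.1.det‖ :=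
  (ContinuousLinearMap.continuous_det.comp continuous_fst).norm

namespace IsStableConstraint

variable {F : Set (Euc 𝕂 d) → Set (EllParam 𝕂 d)} (hF : IsStableConstraint F)
include hF

/-- Both stability conditions apply to `C = D`, which is near itself. -/
theorem isCompact {D : Set (Euc 𝕂 d)} (hD : IsSolidBody D) : IsCompact (F D) := by
  have : ProperSpace (EllParam 𝕂 d) := FiniteDimensional.proper 𝕂 _
  obtain ⟨R, ε, hε, h⟩ := hF.bounded D hD
  refine (isCompact_closedBall _ R).of_isClosed_subset ?_ (h D hD (Near.refl hε D))
  rw [← isOpen_compl_iff, isOpen_iff_mem_nhds]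
  intro q hq
  obtain ⟨N, hN, ε, hε, h⟩ := hF.closed D hD q hq
  exact mem_of_superset hN (disjoint_left.1 (h D hD (Near.refl hε D)))

theorem det_ne_zero {D : Set (Euc 𝕂 d)} (hD : IsSolidBody D) {q : EllParam 𝕂 d}
    (hq : q ∈ maxDet (F D)) : q.1.det ≠ 0 := by
  obtain ⟨q', hq', h⟩ := hF.nondegenerate D hD
  have := hq.2 q' hq'
  intro h0
  rw [h0, norm_zero] at this
  exact h (norm_le_zero_iff.1 this)

theorem exists_mem_maxDet {D : Set (Euc 𝕂 d)} (hD : IsSolidBody D) :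
    (maxDet (F D)).Nonempty := by
  obtain ⟨q', hq', -⟩ := hF.nondegenerate D hD
  obtain ⟨q, hq, h⟩ := (hF.isCompact hD).exists_isMaxOn ⟨q', hq'⟩
    continuous_norm_det.continuousOn
  exact ⟨q, hq, h⟩

/-- The set of maximizers is upper semicontinuous. -/
theorem exists_maxDet_subset {D : Set (Euc 𝕂 d)} (hD : IsSolidBody D) {W : Set (EllParam 𝕂 d)}
    (hW : IsOpen W) (hDW : maxDet (F D) ⊆ W) :
    ∃ ε > 0, ∀ C, IsSolidBody C → Near ε C D → maxDet (F C) ⊆ W := by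
  have : ProperSpace (EllParam 𝕂 d) := FiniteDimensional.proper 𝕂 _
  obtain ⟨R, ε₀, hε₀, hR⟩ := hF.bounded D hD
  obtain ⟨q₀, hq₀⟩ := hF.exists_mem_maxDet hD
  -- Compactness reduces this to one point `q` outside `W`. If `q` is infeasible for `D`, a
  -- neighbourhood stays infeasible for nearby bodies. If it is feasible, it is not optimal, and
  -- feasible competitors persisting from `q₀` beat a neighbourhood of it.
  have key : ∃ ε > 0, ∀ C, IsSolidBody C → Near ε C D →
      Disjoint (Metric.closedBall 0 R \ W) (maxDet (F C)) := by
    refine ((isCompact_closedBall (0 : EllParam 𝕂 d) R).diff hW).induction_on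
      (p := fun s => ∃ ε > 0, ∀ C, IsSolidBody C → Near ε C D → Disjoint s (maxDet (F C)))
      ⟨1, one_pos, fun C _ _ => empty_disjoint _⟩ ?_ ?_ ?_
    · rintro s t hst ⟨ε, hε, h⟩
      exact ⟨ε, hε, fun C hC hn => (h C hC hn).mono_left hst⟩
    · rintro s t ⟨ε, hε, h⟩ ⟨ε', hε', h'⟩
      exact ⟨min ε ε', lt_min hε hε', fun C hC hn => disjoint_union_left.2
        ⟨h C hC (hn.mono (min_le_left _ _)), h' C hC (hn.mono (min_le_right _ _))⟩⟩
    · rintro q ⟨-, hqW⟩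
      by_cases hq : q ∈ F D
      · have hlt : ‖q.1.det‖ < ‖q₀.1.det‖ := by
          by_contra! hle
          exact hqW (hDW ⟨hq, fun q' hq' => (hq₀.2 q' hq').trans hle⟩)
        obtain ⟨m, hm1, hm2⟩ := exists_between hlt
        obtain ⟨ε, hε, h⟩ := hF.lower D hD q₀ hq₀.1 m hm2
        refine ⟨{q' | ‖q'.1.det‖ < m}, mem_nhdsWithin_of_mem_nhds
          ((isOpen_Iio.preimage continuous_norm_det).mem_nhds hm1), ε, hε, fun C hC hn => ?_⟩
        obtain ⟨q', hq', hlt'⟩ := h C hC hn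
        refine disjoint_left.2 fun q'' hq'' hmax => ?_
        have h1 := hmax.2 q' hq'
        have h2 : ‖q''.1.det‖ < m := hq''
        linarith
      · obtain ⟨N, hN, ε, hε, h⟩ := hF.closed D hD q hq
        exact ⟨N, mem_nhdsWithin_of_mem_nhds hN, ε, hε, fun C hC hn =>
          (h C hC hn).mono_right fun q' hq' => hq'.1⟩
  obtain ⟨ε, hε, h⟩ := key
  refine ⟨min ε₀ ε, lt_min hε₀ hε, fun C hC hn q hq => ?_⟩
  by_contra hqW
  exact disjoint_left.1 (h C hC (hn.mono (min_le_right _ _)))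
    ⟨hR C hC (hn.mono (min_le_left _ _)) hq.1, hqW⟩ hq

end IsStableConstraint

theorem norm_det_ofReal_smul {s : ℝ} (hs : 0 ≤ s) (A : Euc 𝕂 d →L[𝕂] Euc 𝕂 d) :
    ‖((s : 𝕂) • A).det‖ = s ^ d * ‖A.det‖ := by
  have : ((s : 𝕂) • A).det = (s : 𝕂) ^ d * A.det := by
    rw [ContinuousLinearMap.det, ContinuousLinearMap.toLinearMap_smul, LinearMap.det_smul,
      finrank_euclideanSpace_fin, ContinuousLinearMap.det]
  rw [this, norm_mul, norm_pow, RCLike.norm_ofReal, abs_of_nonneg hs]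

/-- Shrinking by a factor slightly below `1` costs arbitrarily little determinant and creates room
for perturbing the body. -/
theorem exists_lt_pow_mul {m D : ℝ} (h : m < D) (d : ℕ) :
    ∃ s : ℝ, 0 < s ∧ s < 1 ∧ m < s ^ d * D := by
  have hc : ContinuousAt (fun s : ℝ => s ^ d * D) 1 := by fun_prop
  have h1 : ∀ᶠ s in 𝓝[<] (1 : ℝ), m < s ^ d * D :=
    (hc.eventually (lt_mem_nhds (by simpa using h))).filter_mono nhdsWithin_le_nhds
  have h2 : ∀ᶠ s in 𝓝[<] (1 : ℝ), s ∈ Ioo (0 : ℝ) 1 := Ioo_mem_nhdsLT one_pos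
  obtain ⟨s, hs, hs'⟩ := (h1.and h2).exists
  exact ⟨s, hs'.1, hs'.2, hs⟩

/-- The affine maps that send the unit ball into `C`. -/
def innerConstraint (C : Set (Euc 𝕂 d)) : Set (EllParam 𝕂 d) :=
  {q | ∀ u, ‖u‖ ≤ 1 → q.2 + q.1 u ∈ C}

/-- The affine maps `x ↦ A x - b` that send `C` into the unit ball. -/
def outerConstraint (C : Set (Euc 𝕂 d)) : Set (EllParam 𝕂 d) :=
  {q | ∀ x ∈ C, ‖q.1 x - q.2‖ ≤ 1}

theorem isStableConstraint_inner :
    IsStableConstraint (innerConstraint : Set (Euc 𝕂 d) → Set (EllParam 𝕂 d)) where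
  bounded D hD := by
    obtain ⟨R, hR, h⟩ := hD.exists_subset_closedBall
    refine ⟨2 * (R + 1), 1, one_pos, fun C hC hn q hq => ?_⟩
    have hCR : ∀ x ∈ C, ‖x‖ ≤ R + 1 := by
      intro x hx
      obtain ⟨y, hy, hxy⟩ := Metric.mem_thickening_iff.1 (hn.1 hx)
      have := norm_le_norm_add_norm_sub' x y
      rw [dist_eq_norm] at hxy
      linarith [h y hy]
    have h2 : ‖q.2‖ ≤ R + 1 := hCR _ (by simpa using hq 0 (by simp))
    have h1 : ‖q.1‖ ≤ 2 * (R + 1) := by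
      refine ContinuousLinearMap.opNorm_le_of_unit_norm (by positivity) fun u hu => ?_
      have := hCR _ (hq u hu.le)
      have h3 := norm_sub_le (q.2 + q.1 u) q.2
      rw [add_sub_cancel_left] at h3
      linarith
    rw [mem_closedBall_zero_iff, Prod.norm_def]
    exact max_le h1 (by linarith)
  closed D hD q hq := by
    simp only [innerConstraint, mem_ofPred_eq, not_forall] at hq
    obtain ⟨u, hu, hqu⟩ := hq
    obtain ⟨δ, hδ, h⟩ := (disjoint_singleton_left.2 hqu).exists_thickenings isCompact_singleton
      hD.isCompact.isClosed
    have hc : Continuous fun q : EllParam 𝕂 d => q.2 + q.1 u := by fun_prop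
    refine ⟨(fun q : EllParam 𝕂 d => q.2 + q.1 u) ⁻¹' Metric.thickening δ {q.2 + q.1 u},
      hc.continuousAt.preimage_mem_nhds ?_, δ, hδ, fun C hC hn => ?_⟩
    · exact Metric.isOpen_thickening.mem_nhds (Metric.self_subset_thickening hδ _ rfl)
    · exact disjoint_left.2 fun q' hq' hq'F => disjoint_left.1 h hq' (hn.1 (hq'F u hu))
  lower D hD q hq m hm := by
    obtain ⟨s, hs0, hs1, hs⟩ := exists_lt_pow_mul hm d
    obtain ⟨p, r, hr, hpr⟩ := hD.exists_closedBall_subset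
    have hsr : 0 < (1 - s) * r := mul_pos (by linarith) hr
    -- After shrinking towards `p` by `s`, every point of the ellipsoid is the centre of a ball of
    -- radius `(1 - s) r` in `D`; half of that is a tolerance under which it still lies in `C`.
    refine ⟨(1 - s) * r / 2, by positivity, fun C hC hn =>
      ⟨((s : 𝕂) • q.1, (s : 𝕂) • q.2 + ((1 - s : ℝ) : 𝕂) • p), fun u hu => ?_, ?_⟩⟩
    · refine hC.convex.mem_of_closedBall_subset_thickening hC.isCompact.isClosed hsr
        (half_lt_self hsr) (Subset.trans ?_ hn.2)
      have := hD.convex.closedBall_shrink_subset hpr (hq u hu) hs0.le hs1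
      convert this using 2
      simp only [← RCLike.real_smul_eq_coe_smul, smul_apply, smul_add]
      abel
    · rw [norm_det_ofReal_smul hs0.le]
      exact hs
  nondegenerate D hD := by
    obtain ⟨p, r, hr, hpr⟩ := hD.exists_closedBall_subset
    refine ⟨((r : 𝕂) • 1, p), fun u hu => hpr ?_, ?_⟩
    · rw [mem_closedBall_iff_norm]
      simp only [smul_apply, one_apply_eq_self, add_sub_cancel_left,
        norm_smul, RCLike.norm_ofReal, abs_of_pos hr]
      nlinarith
    · rw [← norm_pos_iff, norm_det_ofReal_smul hr.le]
      simp [ContinuousLinearMap.det]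
      positivity

/-- Nearby bodies contain a common ball of radius `r / 2`. Its image lies in the unit ball, of
diameter `2`, which bounds the operator norm and then the vector. -/
theorem outerConstraint_bounded {D : Set (Euc 𝕂 d)} (hD : IsSolidBody D) :
    ∃ R ε, 0 < ε ∧ ∀ C, IsSolidBody C → Near ε C D →
      outerConstraint C ⊆ Metric.closedBall 0 R := by
  obtain ⟨p, r, hr, hpr⟩ := hD.exists_closedBall_subset
  refine ⟨max (2 / (r / 2)) (1 + 2 / (r / 2) * ‖p‖), r / 4, by positivity,
    fun C hC hn q hq => ?_⟩
  have hsub := hn.closedBall_subset hC.convex hC.isCompact.isClosed (by linarith) hr hpr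
  have hp := hq p (hsub (Metric.mem_closedBall_self (by positivity)))
  have h1 : ‖q.1‖ ≤ 2 / (r / 2) := by
    refine ContinuousLinearMap.opNorm_le_of_unit_norm (by positivity) fun u hu => ?_
    have := hq (p + ((r / 2 : ℝ) : 𝕂) • u) (hsub (by
      rw [mem_closedBall_iff_norm, add_sub_cancel_left, norm_smul, hu, RCLike.norm_ofReal,
        abs_of_pos (by positivity), mul_one]))
    have h3 := norm_sub_le (q.1 (p + ((r / 2 : ℝ) : 𝕂) • u) - q.2) (q.1 p - q.2)
    rw [sub_sub_sub_cancel_right, ← map_sub, add_sub_cancel_left, map_smul, norm_smul,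
      RCLike.norm_ofReal, abs_of_pos (by positivity)] at h3
    rw [le_div_iff₀ (by positivity)]
    linarith
  rw [mem_closedBall_zero_iff, Prod.norm_def]
  refine max_le_max h1 ?_
  have h3 := norm_sub_le (q.1 p) (q.1 p - q.2)
  rw [sub_sub_cancel] at h3
  have h4 := q.1.le_of_opNorm_le h1 p
  linarith

theorem outerConstraint_closed {D : Set (Euc 𝕂 d)} {q : EllParam 𝕂 d}
    (hq : q ∉ outerConstraint D) : ∃ N ∈ 𝓝 q, ∃ ε > 0, ∀ C, IsSolidBody C → Near ε C D →
      Disjoint N (outerConstraint C) := by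
  simp only [outerConstraint, mem_ofPred_eq, not_forall, not_le] at hq
  obtain ⟨x, hx, hqx⟩ := hq
  obtain ⟨a, ha1, haq⟩ := exists_between hqx
  have hc : Continuous fun q : EllParam 𝕂 d => ‖q.1 x - q.2‖ := by fun_prop
  have hc' : Continuous fun q : EllParam 𝕂 d => ‖q.1‖ := by fun_prop
  -- The radius is chosen so that replacing `x` by a nearby point of `C` changes the value by less
  -- than `a - 1`, uniformly over these `q'`.
  refine ⟨{q' | a < ‖q'.1 x - q'.2‖} ∩ {q' | ‖q'.1‖ < ‖q.1‖ + 1},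
    inter_mem (hc.continuousAt.eventually (lt_mem_nhds haq))
      (hc'.continuousAt.eventually (gt_mem_nhds (lt_add_one _))),
    (a - 1) / (‖q.1‖ + 1), div_pos (by linarith) (by positivity),
    fun C hC hn => disjoint_left.2 ?_⟩
  rintro q' ⟨h1, h2⟩ hq'
  simp only [mem_ofPred_eq] at h1 h2
  obtain ⟨y, hy, hxy⟩ := Metric.mem_thickening_iff.1 (hn.2 hx)
  rw [dist_eq_norm, lt_div_iff₀ (by positivity)] at hxy
  have h3 : q'.1 x - q'.2 = (q'.1 y - q'.2) + q'.1 (x - y) := by rw [map_sub]; abel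
  have h4 : ‖q'.1 x - q'.2‖ ≤ 1 + ‖q'.1‖ * ‖x - y‖ := by
    rw [h3]
    exact (norm_add_le _ _).trans (add_le_add (hq' y hy) (q'.1.le_opNorm _))
  have h5 : ‖q'.1‖ * ‖x - y‖ ≤ (‖q.1‖ + 1) * ‖x - y‖ :=
    mul_le_mul_of_nonneg_right h2.le (norm_nonneg _)
  linarith

theorem outerConstraint_lower {D : Set (Euc 𝕂 d)} {q : EllParam 𝕂 d}
    (hq : q ∈ outerConstraint D) {m : ℝ} (hm : m < ‖q.1.det‖) :
    ∃ ε > 0, ∀ C, IsSolidBody C → Near ε C D → ∃ q' ∈ outerConstraint C, m < ‖q'.1.det‖ := by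
  obtain ⟨s, hs0, hs1, hs⟩ := exists_lt_pow_mul hm d
  -- On `C` the norm is at most `1 + (1 - s)`, and `s (2 - s) ≤ 1`.
  refine ⟨(1 - s) / (‖q.1‖ + 1), div_pos (by linarith) (by positivity), fun C hC hn =>
    ⟨((s : 𝕂) • q.1, (s : 𝕂) • q.2), fun x hx => ?_, ?_⟩⟩
  · obtain ⟨y, hy, hxy⟩ := Metric.mem_thickening_iff.1 (hn.1 hx)
    have h1 := hq y hy
    rw [dist_eq_norm, lt_div_iff₀ (by positivity)] at hxy
    have h2 : q.1 x - q.2 = (q.1 y - q.2) + q.1 (x - y) := by rw [map_sub]; abel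
    have h3 : ‖q.1 x - q.2‖ ≤ 1 + ‖q.1‖ * ‖x - y‖ := by
      rw [h2]
      exact (norm_add_le _ _).trans (add_le_add h1 (q.1.le_opNorm _))
    simp only [smul_apply]
    rw [← smul_sub, norm_smul, RCLike.norm_ofReal, abs_of_pos hs0]
    have h4 : ‖q.1‖ * ‖x - y‖ ≤ 1 - s := by nlinarith [norm_nonneg (x - y)]
    nlinarith
  · rw [norm_det_ofReal_smul hs0.le]
    exact hs

theorem isStableConstraint_outer :
    IsStableConstraint (outerConstraint : Set (Euc 𝕂 d) → Set (EllParam 𝕂 d)) where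
  bounded D hD := outerConstraint_bounded hD
  closed D hD q hq := outerConstraint_closed hq
  lower D hD q hq m hm := outerConstraint_lower hq hm
  nondegenerate D hD := by
    obtain ⟨R, hR, h⟩ := hD.exists_subset_closedBall
    refine ⟨(((R⁻¹ : ℝ) : 𝕂) • 1, 0), fun x hx => ?_, ?_⟩
    · rw [sub_zero, smul_apply, one_apply_eq_self, norm_smul, RCLike.norm_ofReal,
        abs_of_pos (inv_pos.2 hR), inv_mul_le_iff₀ hR, mul_one]
      exact h x hx
    · rw [← norm_pos_iff, norm_det_ofReal_smul (inv_pos.2 hR).le]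
      simp [ContinuousLinearMap.det]
      positivity

end MaxDet

/-! ### Uniqueness of optimal ellipsoids -/

section Uniqueness

variable {𝕂 : Type*} [RCLike 𝕂] {d : ℕ}

theorem ContinuousLinearMap.det_mul' (A B : Euc 𝕂 d →L[𝕂] Euc 𝕂 d) :
    (A * B).det = A.det * B.det :=
  LinearMap.det_comp (A : Euc 𝕂 d →ₗ[𝕂] Euc 𝕂 d) (B : Euc 𝕂 d →ₗ[𝕂] Euc 𝕂 d)

theorem exists_mul_eq_one_of_det_ne_zero {A : Euc 𝕂 d →L[𝕂] Euc 𝕂 d} (hA : A.det ≠ 0) :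
    ∃ B, A * B = 1 ∧ B * A = 1 := by
  refine ⟨((A.toContinuousLinearEquivOfDetNeZero hA).symm : Euc 𝕂 d →L[𝕂] Euc 𝕂 d), ?_, ?_⟩
  · ext1 x
    exact (A.toContinuousLinearEquivOfDetNeZero hA).apply_symm_apply x
  · ext1 x
    exact (A.toContinuousLinearEquivOfDetNeZero hA).symm_apply_apply x

/-- The image of the unit ball under `u ↦ A u + c`. -/
def innerSet (q : EllParam 𝕂 d) : Set (Euc 𝕂 d) :=
  (fun u => q.2 + q.1 u) '' Metric.closedBall 0 1

/-- The preimage of the unit ball under `x ↦ A x - b`. -/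
def outerSet (q : EllParam 𝕂 d) : Set (Euc 𝕂 d) :=
  {x | ‖q.1 x - q.2‖ ≤ 1}

theorem innerSet_subset_iff {q : EllParam 𝕂 d} {C : Set (Euc 𝕂 d)} :
    innerSet q ⊆ C ↔ q ∈ innerConstraint C := by
  simp [innerSet, innerConstraint, subset_def]

theorem subset_outerSet_iff {q : EllParam 𝕂 d} {C : Set (Euc 𝕂 d)} :
    C ⊆ outerSet q ↔ q ∈ outerConstraint C :=
  Iff.rfl

theorem innerSet_mul_unitary {A U : Euc 𝕂 d →L[𝕂] Euc 𝕂 d} (c : Euc 𝕂 d)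
    (hU : U ∈ unitary (Euc 𝕂 d →L[𝕂] Euc 𝕂 d)) : innerSet (A * U, c) = innerSet (A, c) := by
  have hle : ∀ (A U : Euc 𝕂 d →L[𝕂] Euc 𝕂 d), U ∈ unitary (Euc 𝕂 d →L[𝕂] Euc 𝕂 d) →
      innerSet (A * U, c) ⊆ innerSet (A, c) := by
    rintro A U hU _ ⟨u, hu, rfl⟩
    refine ⟨U u, ?_, rfl⟩
    rw [mem_closedBall_zero_iff] at hu ⊢
    rwa [ContinuousLinearMap.norm_map_of_mem_unitary hU]
  refine (hle A U hU).antisymm ?_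
  have := hle (A * U) (star U) (Unitary.star_mem hU)
  rwa [mul_assoc, Unitary.mul_star_self_of_mem hU, mul_one] at this

theorem outerSet_unitary_mul {A U : Euc 𝕂 d →L[𝕂] Euc 𝕂 d} (b : Euc 𝕂 d)
    (hU : U ∈ unitary (Euc 𝕂 d →L[𝕂] Euc 𝕂 d)) : outerSet (U * A, U b) = outerSet (A, b) := by
  ext x
  simp only [outerSet, mem_ofPred_eq, mul_apply_eq_comp]
  rw [← map_sub, ContinuousLinearMap.norm_map_of_mem_unitary hU]

theorem mem_innerConstraint_mul_unitary {C : Set (Euc 𝕂 d)} {A U : Euc 𝕂 d →L[𝕂] Euc 𝕂 d}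
    {c : Euc 𝕂 d} (hU : U ∈ unitary (Euc 𝕂 d →L[𝕂] Euc 𝕂 d)) :
    (A * U, c) ∈ innerConstraint C ↔ (A, c) ∈ innerConstraint C := by
  rw [← innerSet_subset_iff, innerSet_mul_unitary c hU, innerSet_subset_iff]

theorem mem_outerConstraint_unitary_mul {C : Set (Euc 𝕂 d)} {A U : Euc 𝕂 d →L[𝕂] Euc 𝕂 d}
    {b : Euc 𝕂 d} (hU : U ∈ unitary (Euc 𝕂 d →L[𝕂] Euc 𝕂 d)) :
    (U * A, U b) ∈ outerConstraint C ↔ (A, b) ∈ outerConstraint C := by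
  rw [← subset_outerSet_iff, outerSet_unitary_mul b hU, subset_outerSet_iff]

/-- Maximal inner ellipsoids agree up to translation. -/
theorem exists_unitary_of_mem_maxDet_inner {C : Set (Euc 𝕂 d)} (hC : IsSolidBody C)
    {q₁ q₂ : EllParam 𝕂 d} (h₁ : q₁ ∈ maxDet (innerConstraint C))
    (h₂ : q₂ ∈ maxDet (innerConstraint C)) :
    ∃ U ∈ unitary (Euc 𝕂 d →L[𝕂] Euc 𝕂 d), q₂.1 = q₁.1 * U := by
  have hdet := isStableConstraint_inner.det_ne_zero hC h₁
  obtain ⟨B, hAB, hBA⟩ := exists_mul_eq_one_of_det_ne_zero hdet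
  have hpos : 0 < ‖q₁.1.det‖ := norm_pos_iff.2 hdet
  have heq : q₁.1 * (B * q₂.1) = q₂.1 := by rw [← mul_assoc, hAB, one_mul]
  -- Linear parts are measured relative to `q₁.1`, so that the identity is optimal; letting the
  -- centre vary freely makes the set of linear parts convex.
  refine ⟨B * q₂.1, mem_unitary_of_norm_det_eq_one
    (G := {M | ∃ c, (q₁.1 * M, c) ∈ innerConstraint C}) ?_ ?_ ⟨q₁.2, by simpa using h₁.1⟩ ?_
    ⟨q₂.2, by rw [heq]; exact h₂.1⟩ ?_, heq.symm⟩
  · rintro M ⟨c, hc⟩ N ⟨c', hc'⟩ a b ha hb hab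
    refine ⟨a • c + b • c', fun u hu => ?_⟩
    have := hC.convex (hc u hu) (hc' u hu) ha hb hab
    convert this using 1
    simp only [mul_apply_eq_comp, add_apply, smul_apply, map_add, smul_add,
      RCLike.real_smul_eq_coe_smul (K := 𝕂), map_smul]
    abel
  · rintro M ⟨c, hc⟩ U hU
    exact ⟨c, by rw [← mul_assoc]; exact (mem_innerConstraint_mul_unitary hU).2 hc⟩
  · rintro M ⟨c, hc⟩
    have := h₁.2 _ hc
    rw [ContinuousLinearMap.det_mul', norm_mul] at this
    exact (mul_le_iff_le_one_right hpos).1 this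
  · have h := congrArg (fun A => ‖ContinuousLinearMap.det A‖) heq
    simp only [ContinuousLinearMap.det_mul' q₁.1, norm_mul] at h
    rw [le_antisymm (h₁.2 _ h₂.1) (h₂.2 _ h₁.1)] at h
    exact mul_left_cancel₀ hpos.ne' (h.trans (mul_one _).symm)

/-- Elongating an ellipsoid along the segment swept by the translates `c + λ A w`. -/
theorem exists_lt_det_of_translates_subset {C : Set (Euc 𝕂 d)} (hC : Convex ℝ C)
    {A : Euc 𝕂 d →L[𝕂] Euc 𝕂 d} (hA : A.det ≠ 0) {c w : Euc 𝕂 d} (hw : w ≠ 0)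
    (h : ∀ l : 𝕂, ‖l‖ = 1 → ∀ u, ‖u‖ ≤ 1 → c + A (l • w + u) ∈ C) :
    ∃ q ∈ innerConstraint C, ‖A.det‖ < ‖q.1.det‖ := by
  have hw' : 0 < ‖w‖ := norm_pos_iff.2 hw
  set f : Euc 𝕂 d →L[𝕂] 𝕂 := ((‖w‖⁻¹ : ℝ) : 𝕂) • innerSL 𝕂 w with hf
  have hfu : ∀ u, ‖u‖ ≤ 1 → ‖f u‖ ≤ 1 := by
    intro u hu
    rw [hf, smul_apply, norm_smul, innerSL_apply_apply, RCLike.norm_ofReal,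
      abs_of_pos (inv_pos.2 hw'), inv_mul_le_iff₀ hw']
    refine (norm_inner_le_norm w u).trans ?_
    gcongr
  have hfw : f w = (‖w‖ : 𝕂) := by
    rw [hf, smul_apply, innerSL_apply_apply, inner_self_eq_norm_sq_to_K, smul_eq_mul,
      RCLike.ofReal_inv]
    have : (‖w‖ : 𝕂) ≠ 0 := RCLike.ofReal_ne_zero.2 hw'.ne'
    field_simp
  -- `T u = u + f(u) w` stretches by `1 + ‖w‖` in the direction `w`. On the unit ball `|f u| ≤ 1`,
  -- so `T u` lies on a segment from `u + l w` to `u - l w` with `|l| = 1`.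
  set T : Euc 𝕂 d →L[𝕂] Euc 𝕂 d :=
    (LinearMap.transvection (f : Euc 𝕂 d →ₗ[𝕂] 𝕂) w).toContinuousLinearMap with hT
  have hTu : ∀ u, T u = u + f u • w := fun u => rfl
  have hTdet : T.det = 1 + (‖w‖ : 𝕂) := by
    rw [hT, LinearMap.det_toContinuousLinearMap, LinearMap.transvection.det]
    exact congrArg _ hfw
  refine ⟨(A * T, c), fun u hu => ?_, ?_⟩
  · obtain ⟨l, hl, hfl⟩ : ∃ l : 𝕂, ‖l‖ = 1 ∧ f u = (‖f u‖ : 𝕂) * l := by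
      by_cases h0 : f u = 0
      · exact ⟨1, by simp, by simp [h0]⟩
      · have : (‖f u‖ : 𝕂) ≠ 0 := by simpa using h0
        refine ⟨f u / ‖f u‖, ?_, by field_simp⟩
        rw [norm_div, RCLike.norm_ofReal, abs_norm, div_self (by simpa using h0)]
    set τ := ‖f u‖
    have hτ : τ ≤ 1 := hfu u hu
    have hτ0 : 0 ≤ τ := norm_nonneg _
    have := hC (h l hl u hu) (h (-l) (by rwa [norm_neg]) u hu) (a := (1 + τ) / 2)
      (b := (1 - τ) / 2) (by linarith) (by linarith) (by ring)
    convert this using 1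
    simp only [mul_apply_eq_comp, hTu, hfl]
    simp only [RCLike.real_smul_eq_coe_smul (K := 𝕂), map_add, map_smul, neg_smul, map_neg]
    push_cast
    module
  · rw [ContinuousLinearMap.det_mul', norm_mul, hTdet]
    have h1 : ‖(1 : 𝕂) + (‖w‖ : 𝕂)‖ = 1 + ‖w‖ := by
      rw [← RCLike.ofReal_one, ← RCLike.ofReal_add, RCLike.norm_ofReal, abs_of_pos (by positivity)]
    rw [h1]
    exact lt_mul_of_one_lt_right (norm_pos_iff.2 hA) (by linarith)

/-- Uniqueness of the maximal inner ellipsoid over scalar fields with only the units `1`, `-1`. -/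
theorem innerSet_eq_of_mem_maxDet_of_units (hunits : ∀ l : 𝕂, ‖l‖ = 1 → l = 1 ∨ l = -1)
    {C : Set (Euc 𝕂 d)} (hC : IsSolidBody C) {q₁ q₂ : EllParam 𝕂 d}
    (h₁ : q₁ ∈ maxDet (innerConstraint C)) (h₂ : q₂ ∈ maxDet (innerConstraint C)) :
    innerSet q₁ = innerSet q₂ := by
  obtain ⟨U, hU, hq⟩ := exists_unitary_of_mem_maxDet_inner hC h₁ h₂
  obtain ⟨A, c₁⟩ := q₁
  obtain ⟨A', c₂⟩ := q₂
  simp only at hq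
  subst hq
  have hdet := isStableConstraint_inner.det_ne_zero hC h₁
  rw [innerSet_mul_unitary _ hU]
  suffices c₁ = c₂ by rw [this]
  by_contra hne
  obtain ⟨B, hAB, hBA⟩ := exists_mul_eq_one_of_det_ne_zero hdet
  have hAB' : ∀ x, A (B x) = x := fun x => by
    rw [← mul_apply_eq_comp, hAB, one_apply_eq_self]
  have hc₂ : (A, c₂) ∈ innerConstraint C := (mem_innerConstraint_mul_unitary hU).1 h₂.1
  -- With the midpoint as centre and `A w` half the difference of the centres, the translates for `l
  -- = 1` and `l = -1` are exactly the two given ellipsoids.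
  obtain ⟨q, hq, hlt⟩ := exists_lt_det_of_translates_subset hC.convex hdet
    (c := (1 / 2 : 𝕂) • (c₁ + c₂)) (w := B ((1 / 2 : 𝕂) • (c₂ - c₁))) (by
      intro h0
      have := hAB' ((1 / 2 : 𝕂) • (c₂ - c₁))
      rw [h0, map_zero, eq_comm, smul_eq_zero] at this
      rcases this with h | h
      · norm_num at h
      · exact hne (sub_eq_zero.1 h).symm) (by
      intro l hl u hu
      rcases hunits l hl with rfl | rfl
      · convert hc₂ u hu using 1
        simp only [one_smul, map_add, hAB']
        module
      · convert h₁.1 u hu using 1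
        simp only [neg_smul, one_smul, map_add, map_neg, hAB']
        module)
  exact absurd (h₁.2 q hq) (not_le.2 hlt)

/-- Uniqueness of the maximal inner ellipsoid for translates of balanced bodies. -/
theorem innerSet_eq_of_mem_maxDet_of_balanced {C : Set (Euc 𝕂 d)} (hC : IsSolidBody C)
    {p : Euc 𝕂 d} (hp : Balanced 𝕂 ((fun v => v - p) '' C)) {q₁ q₂ : EllParam 𝕂 d}
    (h₁ : q₁ ∈ maxDet (innerConstraint C)) (h₂ : q₂ ∈ maxDet (innerConstraint C)) :
    innerSet q₁ = innerSet q₂ := by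
  -- Rotating an off-centre ellipsoid about `p` by all unit scalars stays inside `C` and yields the
  -- circle of translates needed for elongation.
  have key : ∀ q ∈ maxDet (innerConstraint C), q.2 = p := by
    rintro ⟨A, c⟩ hq
    by_contra hne
    have hdet := isStableConstraint_inner.det_ne_zero hC hq
    obtain ⟨B, hAB, hBA⟩ := exists_mul_eq_one_of_det_ne_zero hdet
    have hAB' : ∀ x, A (B x) = x := fun x => by
      rw [← mul_apply_eq_comp, hAB, one_apply_eq_self]
    obtain ⟨q, hq', hlt⟩ := exists_lt_det_of_translates_subset hC.convex hdet
      (c := p) (w := B (c - p)) (by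
        intro h0
        have := hAB' (c - p)
        rw [h0, map_zero, eq_comm, sub_eq_zero] at this
        exact hne this) (by
        intro l hl u hu
        have hl0 : l ≠ 0 := by rintro rfl; simp at hl
        -- The argument `l⁻¹ • u` compensates for the rotation by `l`, so that only the centre is
        -- rotated.
        have hmem := hq.1 (l⁻¹ • u) (by rw [norm_smul, norm_inv, hl]; simpa using hu)
        obtain ⟨z, hz, hzeq⟩ := hp l hl.le (smul_mem_smul_set (mem_image_of_mem _ hmem))
        convert hz using 1
        have hz' : z = p + l • (c + A (l⁻¹ • u) - p) := by rw [← hzeq]; simp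
        rw [hz']
        simp only [map_add, map_smul, hAB', smul_add, smul_sub, smul_smul, mul_inv_cancel₀ hl0,
          one_smul]
        abel)
    exact absurd (hq.2 q hq') (not_le.2 hlt)
  obtain ⟨U, hU, hq⟩ := exists_unitary_of_mem_maxDet_inner hC h₁ h₂
  have hc₁ := key _ h₁
  have hc₂ := key _ h₂
  obtain ⟨A, c₁⟩ := q₁
  obtain ⟨A', c₂⟩ := q₂
  simp only at hq hc₁ hc₂
  rw [hq, innerSet_mul_unitary _ hU, hc₁, hc₂]

/-- Uniqueness of the minimal outer ellipsoid. -/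
theorem outerSet_eq_of_mem_maxDet {C : Set (Euc 𝕂 d)} (hC : IsSolidBody C)
    {q₁ q₂ : EllParam 𝕂 d} (h₁ : q₁ ∈ maxDet (outerConstraint C))
    (h₂ : q₂ ∈ maxDet (outerConstraint C)) : outerSet q₁ = outerSet q₂ := by
  have hdet := isStableConstraint_outer.det_ne_zero hC h₁
  obtain ⟨A, b₁⟩ := q₁
  obtain ⟨A', b₂⟩ := q₂
  simp only at hdet
  obtain ⟨B, hAB, hBA⟩ := exists_mul_eq_one_of_det_ne_zero hdet
  have hpos : 0 < ‖A.det‖ := norm_pos_iff.2 hdet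
  have heq : A' * B * A = A' := by rw [mul_assoc, hBA, mul_one]
  -- Here convexity and unitary invariance come from the unit ball in the target, so unitaries act
  -- on the left.
  have hU : A' * B ∈ unitary (Euc 𝕂 d →L[𝕂] Euc 𝕂 d) := by
    refine mem_unitary_of_norm_det_eq_one_left
      (G := {M | ∃ b, (M * A, b) ∈ outerConstraint C}) ?_ ?_ ⟨b₁, by simpa using h₁.1⟩ ?_
      ⟨b₂, by rw [heq]; exact h₂.1⟩ ?_
    · rintro M ⟨c, hc⟩ N ⟨c', hc'⟩ a b ha hb hab
      refine ⟨a • c + b • c', fun x hx => ?_⟩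
      have := convex_closedBall (0 : Euc 𝕂 d) 1 (mem_closedBall_zero_iff.2 (hc x hx))
        (mem_closedBall_zero_iff.2 (hc' x hx)) ha hb hab
      rw [mem_closedBall_zero_iff] at this
      refine le_of_eq_of_le (congrArg norm ?_) this
      simp only [add_mul, add_apply, mul_apply_eq_comp, smul_apply, smul_sub]
      abel
    · rintro M ⟨c, hc⟩ U hU
      exact ⟨U c, by rw [mul_assoc]; exact (mem_outerConstraint_unitary_mul hU).2 hc⟩
    · rintro M ⟨c, hc⟩
      have := h₁.2 _ hc
      rw [ContinuousLinearMap.det_mul', norm_mul] at this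
      exact (mul_le_iff_le_one_left hpos).1 this
    · have h := congrArg (fun A => ‖ContinuousLinearMap.det A‖) heq
      simp only [ContinuousLinearMap.det_mul' (A' * B), norm_mul] at h
      have h12 := le_antisymm (h₁.2 _ h₂.1) (h₂.2 _ h₁.1)
      simp only at h12
      rw [h12] at h
      exact mul_right_cancel₀ hpos.ne' (h.trans (one_mul _).symm)
  set U := A' * B
  set b := star U b₂ with hb
  have hUb : U b = b₂ := by
    rw [hb, ← mul_apply_eq_comp, Unitary.mul_star_self_of_mem hU, one_apply_eq_self]
  rw [← heq, ← hUb, outerSet_unitary_mul _ hU]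
  have hbC : (A, b) ∈ outerConstraint C := by
    rw [← mem_outerConstraint_unitary_mul hU, hUb, heq]
    exact h₂.1
  suffices b₁ = b by rw [this]
  by_contra hne
  have hδ : 0 < ‖b₁ - b‖ := norm_pos_iff.2 (sub_ne_zero.2 hne)
  -- If the vectors differ, their midpoint sends `C` into a strictly smaller ball, so the map can be
  -- scaled up, contradicting maximality.
  have hmid : ∀ x ∈ C, ‖A x - (1 / 2 : 𝕂) • (b₁ + b)‖ ^ 2 ≤ 1 - ‖b₁ - b‖ ^ 2 / 4 := by
    intro x hx
    have hx₁ : ‖A x - b₁‖ ≤ 1 := h₁.1 x hx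
    have hx₂ : ‖A x - b‖ ≤ 1 := hbC x hx
    have hpar := parallelogram_law_with_norm 𝕂 (A x - b₁) (A x - b)
    have e1 : A x - b₁ + (A x - b) = (2 : 𝕂) • (A x - (1 / 2 : 𝕂) • (b₁ + b)) := by module
    have e2 : A x - b₁ - (A x - b) = -(b₁ - b) := by abel
    rw [e1, e2, norm_neg, norm_smul, RCLike.norm_ofNat] at hpar
    nlinarith [norm_nonneg (A x - b₁), norm_nonneg (A x - b)]
  obtain ⟨x₀, hx₀⟩ := hC.interior_nonempty.mono interior_subset
  set ρ := Real.sqrt (1 - ‖b₁ - b‖ ^ 2 / 4) with hρ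
  have hρ1 : ρ < 1 := by
    rw [hρ, Real.sqrt_lt' one_pos]
    nlinarith
  have hmid' : ∀ x ∈ C, ‖A x - (1 / 2 : 𝕂) • (b₁ + b)‖ ≤ ρ := fun x hx =>
    Real.le_sqrt_of_sq_le (hmid x hx)
  obtain ⟨s, hs1, hsρ⟩ : ∃ s : ℝ, 1 < s ∧ s * ρ ≤ 1 := by
    have hρ0 : 0 ≤ ρ := Real.sqrt_nonneg _
    refine ⟨2 - ρ, by linarith, by nlinarith [sq_nonneg (1 - ρ)]⟩
  -- Scaling increases the determinant only in positive dimension; in dimension `0` the two vectors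
  -- coincide.
  have hd : 0 < d := by
    rcases Nat.eq_zero_or_pos d with rfl | h
    · exact absurd (Subsingleton.elim _ _) hne
    · exact h
  have hmem : ((s : 𝕂) • A, (s : 𝕂) • ((1 / 2 : 𝕂) • (b₁ + b))) ∈ outerConstraint C := by
    intro x hx
    simp only [smul_apply]
    rw [← smul_sub, norm_smul, RCLike.norm_ofReal, abs_of_pos (by linarith)]
    exact (mul_le_mul_of_nonneg_left (hmid' x hx) (by linarith)).trans hsρ
  have := h₁.2 _ hmem
  rw [norm_det_ofReal_smul (by linarith)] at this
  have h1s : 1 < s ^ d := one_lt_pow₀ hs1 hd.ne'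
  simp only at this
  nlinarith

end Uniqueness

/-! ### Continuity of ellipsoids in their parameters and of optimal ellipsoids in the body -/

section Stability

variable {𝕂 : Type*} [RCLike 𝕂] {d : ℕ}

/-- Ellipsoids depend continuously on their parameters. -/
theorem near_innerSet_of_dist_lt {q q₀ : EllParam 𝕂 d} {ε : ℝ} (h : dist q q₀ < ε / 2) :
    Near ε (innerSet q) (innerSet q₀) := by
  have hdist : ∀ u ∈ Metric.closedBall (0 : Euc 𝕂 d) 1,
      dist (q.2 + q.1 u) (q₀.2 + q₀.1 u) < ε := by
    intro u hu
    rw [mem_closedBall_zero_iff] at hu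
    rw [Prod.dist_eq, max_lt_iff, dist_eq_norm, dist_eq_norm] at h
    have h1 : ‖(q.1 - q₀.1) u‖ ≤ ‖q.1 - q₀.1‖ := by
      have := (q.1 - q₀.1).le_opNorm u
      nlinarith [norm_nonneg (q.1 - q₀.1)]
    have h2 : q.2 + q.1 u - (q₀.2 + q₀.1 u) = (q.2 - q₀.2) + (q.1 - q₀.1) u := by
      rw [sub_apply]
      abel
    rw [dist_eq_norm, h2]
    linarith [norm_add_le (q.2 - q₀.2) ((q.1 - q₀.1) u)]
  constructor
  · rintro _ ⟨u, hu, rfl⟩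
    exact Metric.mem_thickening_iff.2 ⟨_, mem_image_of_mem _ hu, hdist u hu⟩
  · rintro _ ⟨u, hu, rfl⟩
    exact Metric.mem_thickening_iff.2 ⟨_, mem_image_of_mem _ hu, by
      rw [dist_comm]; exact hdist u hu⟩

theorem eventually_near_innerSet (q₀ : EllParam 𝕂 d) {ε : ℝ} (hε : 0 < ε) :
    ∀ᶠ q in 𝓝 q₀, Near ε (innerSet q) (innerSet q₀) := by
  filter_upwards [Metric.ball_mem_nhds q₀ (half_pos hε)] with q hq
  exact near_innerSet_of_dist_lt hq

theorem outerSet_eq_innerSet {A B : Euc 𝕂 d →L[𝕂] Euc 𝕂 d} (hAB : A * B = 1) (hBA : B * A = 1)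
    (b : Euc 𝕂 d) : outerSet (A, b) = innerSet (B, B b) := by
  have hAB' : ∀ x, A (B x) = x := fun x => by rw [← mul_apply_eq_comp, hAB, one_apply_eq_self]
  have hBA' : ∀ x, B (A x) = x := fun x => by rw [← mul_apply_eq_comp, hBA, one_apply_eq_self]
  ext x
  constructor
  · intro hx
    refine ⟨A x - b, by simpa using! hx, ?_⟩
    simp only [map_sub, hBA']
    abel
  · rintro ⟨u, hu, rfl⟩
    simp only [outerSet, mem_ofPred_eq, map_add, hAB', add_sub_cancel_left]
    simpa using hu

/-- An outer set with invertible `A` is the inner set of `(A⁻¹, A⁻¹ b)`, and inversion is continuous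
at units. -/
theorem eventually_near_outerSet {q₀ : EllParam 𝕂 d} (hq₀ : q₀.1.det ≠ 0) {ε : ℝ} (hε : 0 < ε) :
    ∀ᶠ q in 𝓝 q₀, Near ε (outerSet q) (outerSet q₀) := by
  have hout : ∀ q : EllParam 𝕂 d, q.1.det ≠ 0 →
      outerSet q = innerSet (Ring.inverse q.1, Ring.inverse q.1 q.2) := by
    intro q hq
    obtain ⟨B, hAB, hBA⟩ := exists_mul_eq_one_of_det_ne_zero hq
    have hB : Ring.inverse q.1 = B := Ring.inverse_unit ⟨q.1, B, hAB, hBA⟩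
    rw [hB]
    exact outerSet_eq_innerSet hAB hBA q.2
  have hc : ContinuousAt
      (fun q : EllParam 𝕂 d => ((Ring.inverse q.1, Ring.inverse q.1 q.2) : EllParam 𝕂 d)) q₀ := by
    obtain ⟨B, hAB, hBA⟩ := exists_mul_eq_one_of_det_ne_zero hq₀
    have h1 : ContinuousAt (fun q : EllParam 𝕂 d => Ring.inverse q.1) q₀ :=
      (NormedRing.inverse_continuousAt ⟨q₀.1, B, hAB, hBA⟩).comp
        (f := fun q : EllParam 𝕂 d => q.1) (x := q₀) continuousAt_fst
    exact h1.prodMk (h1.clm_apply continuousAt_snd)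
  have hdet : ∀ᶠ q : EllParam 𝕂 d in 𝓝 q₀, q.1.det ≠ 0 :=
    (ContinuousLinearMap.continuous_det.comp continuous_fst).continuousAt.eventually_ne hq₀
  filter_upwards [hdet, hc.eventually (eventually_near_innerSet _ hε)] with q hq h
  rw [hout q hq, hout q₀ hq₀]
  exact h

/-- If the optimal set `S q` is unique for `D`, then it depends continuously on the body at `D`. -/
theorem IsStableConstraint.exists_near {F : Set (Euc 𝕂 d) → Set (EllParam 𝕂 d)}
    (hF : IsStableConstraint F) {S : EllParam 𝕂 d → Set (Euc 𝕂 d)}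
    (hS : ∀ q₀ : EllParam 𝕂 d, q₀.1.det ≠ 0 → ∀ ε > 0, ∀ᶠ q in 𝓝 q₀, Near ε (S q) (S q₀))
    {D : Set (Euc 𝕂 d)} (hD : IsSolidBody D)
    (huniq : ∀ q₁ ∈ maxDet (F D), ∀ q₂ ∈ maxDet (F D), S q₁ = S q₂) {ε : ℝ} (hε : 0 < ε) :
    ∃ δ > 0, ∀ C, IsSolidBody C → Near δ C D → ∀ q ∈ maxDet (F C), ∀ q₀ ∈ maxDet (F D),
      Near ε (S q) (S q₀) := by
  -- Maximizers may form a whole unitary orbit, so the open set surrounds all of them; uniqueness of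
  -- `S` then lets any one serve as reference.
  obtain ⟨δ, hδ, h⟩ := hF.exists_maxDet_subset hD
    (W := ⋃ q₀ ∈ maxDet (F D), interior {q | Near ε (S q) (S q₀)})
    (isOpen_biUnion fun _ _ => isOpen_interior) (fun q₀ hq₀ => mem_biUnion hq₀
      (mem_interior_iff_mem_nhds.2 (hS q₀ (hF.det_ne_zero hD hq₀) ε hε)))
  refine ⟨δ, hδ, fun C hC hn q hq q₀ hq₀ => ?_⟩
  obtain ⟨q₁, hq₁, hqq₁⟩ := mem_iUnion₂.1 (h C hC hn hq)
  rw [huniq q₀ hq₀ q₁ hq₁]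
  have hnear : q ∈ {q | Near ε (S q) (S q₁)} := interior_subset hqq₁
  exact hnear

end Stability

/-! ### Volumes, and ellipsoids of a fibre in coordinates -/

section Fibre

variable {𝕂 : Type*} [RCLike 𝕂] {d : ℕ}

/-- Both sides are the factor by which multiplication by `z` scales Haar measure, read off on the
unit ball. It converts a determinant over `𝕂` into a real volume factor. -/
theorem abs_algebraNorm_eq_norm_pow (z : 𝕂) :
    |Algebra.norm ℝ z| = ‖z‖ ^ Module.finrank ℝ 𝕂 := by
  let _ : MeasurableSpace 𝕂 := borel 𝕂
  have : BorelSpace 𝕂 := ⟨rfl⟩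
  rcases eq_or_ne z 0 with rfl | hz
  · rw [Algebra.norm_zero, abs_zero, norm_zero, zero_pow Module.finrank_pos.ne']
  set μ : Measure 𝕂 := Measure.addHaar
  have h1 := μ.addHaar_image_linearMap (Algebra.lmul ℝ 𝕂 z) (Metric.ball 0 1)
  have h2 : (Algebra.lmul ℝ 𝕂 z) '' Metric.ball 0 1 = Metric.ball 0 ‖z‖ := by
    ext w
    simp only [mem_image, mem_ball_zero_iff, Algebra.coe_lmul_eq_mul, LinearMap.mul_apply']
    constructor
    · rintro ⟨x, hx, rfl⟩
      rw [norm_mul]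
      exact mul_lt_of_lt_one_right (norm_pos_iff.2 hz) hx
    · intro hw
      refine ⟨z⁻¹ * w, ?_, by rw [mul_inv_cancel_left₀ hz]⟩
      rwa [norm_mul, norm_inv, inv_mul_lt_iff₀ (norm_pos_iff.2 hz), mul_one]
  rw [h2, μ.addHaar_ball 0 (norm_nonneg z)] at h1
  have hpos : μ (Metric.ball 0 1) ≠ 0 := (Metric.measure_ball_pos μ 0 one_pos).ne'
  have hfin : μ (Metric.ball 0 1) ≠ ⊤ := measure_ball_lt_top.ne
  have h3 := (ENNReal.mul_left_inj hpos hfin).1 h1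
  rw [ENNReal.ofReal_eq_ofReal_iff (by positivity) (abs_nonneg _)] at h3
  exact h3.symm

variable {V : Type*} [NormedAddCommGroup V] [NormedSpace 𝕂 V]

theorem isEllipsoid_iff (φ : Euc 𝕂 d ≃L[𝕂] V) (S : Set V) :
    IsEllipsoid 𝕂 S ↔ ∃ q : EllParam 𝕂 d, q.1.det ≠ 0 ∧ S = φ '' innerSet q := by
  have hfr : Module.finrank 𝕂 V = d := by
    rw [← φ.toLinearEquiv.finrank_eq, finrank_euclideanSpace_fin]
  subst hfr
  constructor
  · rintro ⟨L, c, rfl⟩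
    refine ⟨(((L.trans φ.symm.toLinearEquiv : Euc 𝕂 _ ≃ₗ[𝕂] Euc 𝕂 _) :
      Euc 𝕂 _ →ₗ[𝕂] Euc 𝕂 _).toContinuousLinearMap, φ.symm c), ?_, ?_⟩
    · rw [LinearMap.det_toContinuousLinearMap]
      exact (LinearEquiv.isUnit_det' _).ne_zero
    · rw [innerSet, image_image]
      refine image_congr fun u _ => ?_
      simp
  · rintro ⟨q, hq, rfl⟩
    refine ⟨((q.1.toContinuousLinearEquivOfDetNeZero hq).trans φ).toLinearEquiv, φ q.2, ?_⟩
    rw [innerSet, image_image]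
    refine image_congr fun u _ => ?_
    simp

variable [NormedSpace ℝ V] [IsScalarTower ℝ 𝕂 V]

theorem measure_image_innerSet [MeasurableSpace V] [BorelSpace V] (φ : Euc 𝕂 d ≃L[𝕂] V)
    (μ : Measure V) [μ.IsAddHaarMeasure] (q : EllParam 𝕂 d) :
    μ (φ '' innerSet q) = ENNReal.ofReal (‖q.1.det‖ ^ Module.finrank ℝ 𝕂) *
      μ (φ '' Metric.closedBall 0 1) := by
  have : FiniteDimensional 𝕂 V := Module.Finite.equiv φ.toLinearEquiv
  have : FiniteDimensional ℝ V := Module.Finite.trans 𝕂 V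
  set f : V →ₗ[𝕂] V := (φ.toLinearEquiv : Euc 𝕂 d →ₗ[𝕂] V) ∘ₗ (q.1 : Euc 𝕂 d →ₗ[𝕂] Euc 𝕂 d) ∘ₗ
    (φ.toLinearEquiv.symm : V →ₗ[𝕂] Euc 𝕂 d) with hf
  have h1 : φ '' innerSet q =
      (fun v => φ q.2 + v) '' ((f.restrictScalars ℝ) '' (φ '' Metric.closedBall 0 1)) := by
    rw [innerSet, image_image, image_image, image_image]
    refine image_congr fun u _ => ?_
    simp [hf]
  rw [h1, image_add_left, measure_preimage_add, Measure.addHaar_image_linearMap,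
    LinearMap.det_restrictScalars, hf, LinearMap.det_conj, abs_algebraNorm_eq_norm_pow]

theorem volLE_iff (φ : Euc 𝕂 d ≃L[𝕂] V) (q q' : EllParam 𝕂 d) :
    VolLE (φ '' innerSet q) (φ '' innerSet q') ↔ ‖q.1.det‖ ≤ ‖q'.1.det‖ := by
  let _ : MeasurableSpace V := borel V
  have : BorelSpace V := ⟨rfl⟩
  have : FiniteDimensional 𝕂 V := Module.Finite.equiv φ.toLinearEquiv
  have : FiniteDimensional ℝ V := Module.Finite.trans 𝕂 V
  have : ProperSpace V := FiniteDimensional.proper ℝ V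
  have key : ∀ μ : Measure V, μ.IsAddHaarMeasure →
      (μ (φ '' innerSet q) ≤ μ (φ '' innerSet q') ↔ ‖q.1.det‖ ≤ ‖q'.1.det‖) := by
    intro μ hμ
    have hpos : μ (φ '' Metric.closedBall 0 1) ≠ 0 := by
      have h := (φ.toHomeomorph.isOpenMap _ (Metric.isOpen_ball (x := (0 : Euc 𝕂 d)) (ε := 1)))
      have h0 := h.measure_pos μ ((Metric.nonempty_ball.2 one_pos).image _)
      exact (h0.trans_le (measure_mono (image_mono Metric.ball_subset_closedBall))).ne'
    have hfin : μ (φ '' Metric.closedBall 0 1) ≠ ⊤ :=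
      ((isCompact_closedBall (0 : Euc 𝕂 d) 1).image φ.continuous).measure_lt_top.ne
    rw [measure_image_innerSet, measure_image_innerSet, ENNReal.mul_le_mul_iff_left hpos hfin,
      ENNReal.ofReal_le_ofReal_iff (by positivity),
      pow_le_pow_iff_left₀ (norm_nonneg _) (norm_nonneg _) Module.finrank_pos.ne']
  constructor
  · intro h
    exact (key Measure.addHaar inferInstance).1 (h Measure.addHaar inferInstance)
  · exact fun h μ hμ => (key μ hμ).2 h

theorem isSolidBody_preimage (φ : Euc 𝕂 d ≃L[𝕂] V) (K : SolidBody V) :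
    IsSolidBody (φ ⁻¹' (K.1 : Set V)) where
  convex := K.1.convex.linear_preimage ((φ.toLinearEquiv : Euc 𝕂 d →ₗ[𝕂] V).restrictScalars ℝ)
  isCompact := φ.toHomeomorph.isCompact_preimage.2 K.1.isCompact
  interior_nonempty := by
    have h := φ.toHomeomorph.preimage_interior (K.1 : Set V)
    have h2 := K.2.preimage φ.surjective
    exact h ▸ h2

/-- The body with the given parameters. -/
theorem exists_solidBody_eq_image (φ : Euc 𝕂 d ≃L[𝕂] V) {q : EllParam 𝕂 d} (hq : q.1.det ≠ 0) :
    ∃ J : SolidBody V, (J.1 : Set V) = φ '' innerSet q := by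
  set ψ : Euc 𝕂 d ≃L[𝕂] V := (q.1.toContinuousLinearEquivOfDetNeZero hq).trans φ with hψ
  have h : φ '' innerSet q = (fun v => φ q.2 + v) '' (ψ '' Metric.closedBall 0 1) := by
    rw [innerSet, image_image, image_image]
    refine image_congr fun u _ => ?_
    simp [hψ]
  have hconv : Convex ℝ (φ '' innerSet q) := by
    rw [h]
    exact ((convex_closedBall (0 : Euc 𝕂 d) 1).linear_image
      ((ψ.toLinearEquiv : Euc 𝕂 d →ₗ[𝕂] V).restrictScalars ℝ)).translate _
  have hcomp : IsCompact (φ '' innerSet q) := by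
    rw [h]
    exact ((isCompact_closedBall (0 : Euc 𝕂 d) 1).image ψ.continuous).image (by fun_prop)
  have hne : (interior (φ '' innerSet q)).Nonempty := by
    rw [h]
    refine Set.Nonempty.mono (interior_maximal (image_mono (image_mono
      (Metric.ball_subset_closedBall (x := (0 : Euc 𝕂 d)) (ε := 1)))) ?_)
      (((Metric.nonempty_ball.2 one_pos).image _).image _)
    exact isOpenMap_add_left _ _ (ψ.toHomeomorph.isOpenMap _ Metric.isOpen_ball)
  exact ⟨⟨⟨φ '' innerSet q, hconv, hcomp, hne.mono interior_subset⟩, hne⟩, rfl⟩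

theorem SolidBody.ext {K L : SolidBody V} (h : (K.1 : Set V) = L.1) : K = L :=
  Subtype.ext (ConvexBody.ext h)

theorem isJohn_iff (φ : Euc 𝕂 d ≃L[𝕂] V) (K J : SolidBody V) :
    IsJohn 𝕂 K J ↔ ∃ q ∈ maxDet (innerConstraint (φ ⁻¹' (K.1 : Set V))),
      (J.1 : Set V) = φ '' innerSet q := by
  constructor
  · rintro ⟨hell, hsub, hmax⟩
    obtain ⟨q, hq, hJ⟩ := (isEllipsoid_iff φ _).1 hell
    refine ⟨q, ⟨?_, fun q' hq' => ?_⟩, hJ⟩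
    · rw [← innerSet_subset_iff, ← image_subset_iff, ← hJ]
      exact hsub
    -- The constraint set also contains degenerate maps, which define no ellipsoid but have
    -- determinant `0` and so cannot win.
    · by_cases h0 : q'.1.det = 0
      · rw [h0, norm_zero]
        exact norm_nonneg _
      · have := hmax (φ '' innerSet q') ((isEllipsoid_iff φ _).2 ⟨q', h0, rfl⟩)
          (image_subset_iff.2 (innerSet_subset_iff.2 hq'))
        rwa [hJ, volLE_iff] at this
  · rintro ⟨q, hq, hJ⟩
    have h0 := isStableConstraint_inner.det_ne_zero (isSolidBody_preimage φ K) hq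
    refine ⟨(isEllipsoid_iff φ _).2 ⟨q, h0, hJ⟩, ?_, ?_⟩
    · rw [hJ, image_subset_iff]
      exact innerSet_subset_iff.2 hq.1
    · intro T hT hTK
      obtain ⟨q', hq', rfl⟩ := (isEllipsoid_iff φ _).1 hT
      rw [hJ, volLE_iff]
      exact hq.2 q' (innerSet_subset_iff.1 (image_subset_iff.1 hTK))

theorem exists_innerSet_eq_outerSet {q : EllParam 𝕂 d} (hq : q.1.det ≠ 0) :
    ∃ q' : EllParam 𝕂 d, ‖q'.1.det‖ = ‖q.1.det‖⁻¹ ∧ innerSet q' = outerSet q := by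
  obtain ⟨B, hAB, hBA⟩ := exists_mul_eq_one_of_det_ne_zero hq
  refine ⟨(B, B q.2), ?_, (outerSet_eq_innerSet hAB hBA q.2).symm⟩
  have := congrArg (fun A => ‖ContinuousLinearMap.det A‖) hBA
  simp only [ContinuousLinearMap.det_mul', norm_mul] at this
  refine eq_inv_of_mul_eq_one_left (this.trans ?_)
  simp [ContinuousLinearMap.det]

theorem exists_outerSet_eq_innerSet {q : EllParam 𝕂 d} (hq : q.1.det ≠ 0) :
    ∃ q' : EllParam 𝕂 d, ‖q'.1.det‖ = ‖q.1.det‖⁻¹ ∧ outerSet q' = innerSet q := by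
  obtain ⟨B, hAB, hBA⟩ := exists_mul_eq_one_of_det_ne_zero hq
  refine ⟨(B, B q.2), ?_, ?_⟩
  · have := congrArg (fun A => ‖ContinuousLinearMap.det A‖) hBA
    simp only [ContinuousLinearMap.det_mul', norm_mul] at this
    refine eq_inv_of_mul_eq_one_left (this.trans ?_)
    simp [ContinuousLinearMap.det]
  · rw [outerSet_eq_innerSet hBA hAB, ← mul_apply_eq_comp, hAB, one_apply_eq_self]

/-- Passing from an inner to an outer description inverts the determinant, so least volume becomes
largest determinant. -/
theorem isLoewner_iff (φ : Euc 𝕂 d ≃L[𝕂] V) (K L : SolidBody V) :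
    IsLoewner 𝕂 K L ↔ ∃ q ∈ maxDet (outerConstraint (φ ⁻¹' (K.1 : Set V))),
      (L.1 : Set V) = φ '' outerSet q := by
  have hsub_iff : ∀ q : EllParam 𝕂 d, (K.1 : Set V) ⊆ φ '' outerSet q ↔
      q ∈ outerConstraint (φ ⁻¹' (K.1 : Set V)) := by
    intro q
    rw [← subset_outerSet_iff, ← image_subset_image_iff φ.injective,
      image_preimage_eq _ φ.surjective]
  constructor
  · rintro ⟨hell, hsub, hmin⟩
    obtain ⟨q, hq, hL⟩ := (isEllipsoid_iff φ _).1 hell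
    obtain ⟨p, hpdet, hp⟩ := exists_outerSet_eq_innerSet hq
    refine ⟨p, ⟨?_, fun p' hp' => ?_⟩, by rw [hp, hL]⟩
    · rw [← hsub_iff, hp, ← hL]
      exact hsub
    · by_cases h0 : p'.1.det = 0
      · rw [h0, norm_zero]
        exact norm_nonneg _
      · obtain ⟨q', hqdet', hq'⟩ := exists_innerSet_eq_outerSet h0
        have hne : q'.1.det ≠ 0 := by
          rw [← norm_pos_iff, hqdet']
          exact inv_pos.2 (norm_pos_iff.2 h0)
        have := hmin (φ '' innerSet q') ((isEllipsoid_iff φ _).2 ⟨q', hne, rfl⟩)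
          (by rw [hq']; exact (hsub_iff p').2 hp')
        rw [hL, volLE_iff, hqdet'] at this
        rw [hpdet]
        exact (le_inv_comm₀ (norm_pos_iff.2 hq) (norm_pos_iff.2 h0)).1 this
  · rintro ⟨p, hp, hL⟩
    have h0 := isStableConstraint_outer.det_ne_zero (isSolidBody_preimage φ K) hp
    obtain ⟨q, hqdet, hq⟩ := exists_innerSet_eq_outerSet h0
    have hne : q.1.det ≠ 0 := by
      rw [← norm_pos_iff, hqdet]
      exact inv_pos.2 (norm_pos_iff.2 h0)
    refine ⟨(isEllipsoid_iff φ _).2 ⟨q, hne, by rw [hq, hL]⟩, ?_, ?_⟩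
    · rw [hL]
      exact (hsub_iff p).2 hp.1
    · intro T hT hKT
      obtain ⟨q', hq', rfl⟩ := (isEllipsoid_iff φ _).1 hT
      obtain ⟨p', hpdet', hp'⟩ := exists_outerSet_eq_innerSet hq'
      have := hp.2 p' ((hsub_iff p').1 (by rw [hp']; exact hKT))
      rw [hL, ← hq, volLE_iff, hqdet]
      rw [hpdet'] at this
      exact inv_le_of_inv_le₀ (norm_pos_iff.2 hq') this

theorem exists_isJohn (φ : Euc 𝕂 d ≃L[𝕂] V) (K : SolidBody V) : ∃ J, IsJohn 𝕂 K J := by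
  have hK := isSolidBody_preimage φ K
  obtain ⟨q, hq⟩ := isStableConstraint_inner.exists_mem_maxDet hK
  obtain ⟨J, hJ⟩ := exists_solidBody_eq_image φ (isStableConstraint_inner.det_ne_zero hK hq)
  exact ⟨J, (isJohn_iff φ K J).2 ⟨q, hq, hJ⟩⟩

theorem existsUnique_isLoewner (φ : Euc 𝕂 d ≃L[𝕂] V) (K : SolidBody V) :
    ∃! L, IsLoewner 𝕂 K L := by
  have hK := isSolidBody_preimage φ K
  obtain ⟨p, hp⟩ := isStableConstraint_outer.exists_mem_maxDet hK
  have h0 := isStableConstraint_outer.det_ne_zero hK hp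
  obtain ⟨q, hqdet, hq⟩ := exists_innerSet_eq_outerSet h0
  have hne : q.1.det ≠ 0 := by
    rw [← norm_pos_iff, hqdet]
    exact inv_pos.2 (norm_pos_iff.2 h0)
  obtain ⟨L, hL⟩ := exists_solidBody_eq_image φ hne
  refine ⟨L, (isLoewner_iff φ K L).2 ⟨p, hp, by rw [hL, hq]⟩, fun L' hL' => ?_⟩
  obtain ⟨p', hp', hLp'⟩ := (isLoewner_iff φ K L').1 hL'
  apply SolidBody.ext
  rw [hL, hq, hLp', outerSet_eq_of_mem_maxDet hK hp hp']

theorem existsUnique_isJohn_of_units (hunits : ∀ l : 𝕂, ‖l‖ = 1 → l = 1 ∨ l = -1)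
    (φ : Euc 𝕂 d ≃L[𝕂] V) (K : SolidBody V) : ∃! J, IsJohn 𝕂 K J := by
  obtain ⟨J, hJ⟩ := exists_isJohn φ K
  refine ⟨J, hJ, fun J' hJ' => SolidBody.ext ?_⟩
  obtain ⟨q, hq, h⟩ := (isJohn_iff φ K J).1 hJ
  obtain ⟨q', hq', h'⟩ := (isJohn_iff φ K J').1 hJ'
  rw [h, h', innerSet_eq_of_mem_maxDet_of_units hunits (isSolidBody_preimage φ K) hq hq']

theorem existsUnique_isJohn_of_balanced (φ : Euc 𝕂 d ≃L[𝕂] V) (K : SolidBody V) {c : V}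
    (hc : Balanced 𝕂 ((fun v => v - c) '' (K.1 : Set V))) : ∃! J, IsJohn 𝕂 K J := by
  obtain ⟨J, hJ⟩ := exists_isJohn φ K
  refine ⟨J, hJ, fun J' hJ' => SolidBody.ext ?_⟩
  obtain ⟨q, hq, h⟩ := (isJohn_iff φ K J).1 hJ
  obtain ⟨q', hq', h'⟩ := (isJohn_iff φ K J').1 hJ'
  have hbal : Balanced 𝕂 ((fun v => v - φ.symm c) '' (φ ⁻¹' (K.1 : Set V))) := by
    rintro a ha _ ⟨_, ⟨x, hx, rfl⟩, rfl⟩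
    obtain ⟨z, hz, hzeq⟩ := hc a ha (smul_mem_smul_set (mem_image_of_mem (fun v => v - c) hx))
    refine ⟨φ.symm z, by simpa using hz, ?_⟩
    have := congrArg φ.symm hzeq
    simpa [smul_sub] using this
  rw [h, h', innerSet_eq_of_mem_maxDet_of_balanced (isSolidBody_preimage φ K) hbal hq hq']

/-- If the John ellipsoid is unique, all maximizers describe the same ellipsoid. -/
theorem innerSet_eq_of_existsUnique_isJohn (φ : Euc 𝕂 d ≃L[𝕂] V) {K : SolidBody V}
    (huniq : ∃! J, IsJohn 𝕂 K J) {q₁ q₂ : EllParam 𝕂 d}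
    (h₁ : q₁ ∈ maxDet (innerConstraint (φ ⁻¹' (K.1 : Set V))))
    (h₂ : q₂ ∈ maxDet (innerConstraint (φ ⁻¹' (K.1 : Set V)))) : innerSet q₁ = innerSet q₂ := by
  have hK := isSolidBody_preimage φ K
  obtain ⟨J₁, hJ₁⟩ := exists_solidBody_eq_image φ (isStableConstraint_inner.det_ne_zero hK h₁)
  obtain ⟨J₂, hJ₂⟩ := exists_solidBody_eq_image φ (isStableConstraint_inner.det_ne_zero hK h₂)
  have := huniq.unique ((isJohn_iff φ K J₁).2 ⟨q₁, h₁, hJ₁⟩)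
    ((isJohn_iff φ K J₂).2 ⟨q₂, h₂, hJ₂⟩)
  rw [this, hJ₂] at hJ₁
  exact (φ.injective.image_injective hJ₁).symm

end Fibre

/-! ### Local frames of weakly full homogeneous bundles -/

section Bundle

variable {𝕂 : Type*} [RCLike 𝕂] {X : Type*} [TopologicalSpace X] {E : X → Type*}
  [∀ x, NormedAddCommGroup (E x)] [∀ x, NormedSpace 𝕂 (E x)] [TopologicalSpace (Tot E)]

namespace IsBanachBundle

variable (hE : IsBanachBundle 𝕂 E)
include hE

theorem continuous_zero : Continuous (fun x : X => (⟨x, 0⟩ : Tot E)) := by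
  rw [continuous_iff_continuousAt]
  intro x
  rw [ContinuousAt, (hE.nhds_zero x).tendsto_right_iff]
  rintro ⟨U, ε⟩ ⟨hU, hε⟩
  filter_upwards [hU] with y hy
  exact ⟨hy, by simpa using hε⟩

theorem continuousAt_add {Z : Type*} [TopologicalSpace Z] {b : Z → X} {f g : ∀ z, E (b z)} {z₀ : Z}
    (hf : ContinuousAt (fun z => (⟨b z, f z⟩ : Tot E)) z₀)
    (hg : ContinuousAt (fun z => (⟨b z, g z⟩ : Tot E)) z₀) :
    ContinuousAt (fun z => (⟨b z, f z + g z⟩ : Tot E)) z₀ := by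
  have h : ContinuousAt (fun z => (⟨b z, (f z, g z)⟩ :
      Bundle.TotalSpace (Unit × Unit) (E ×ᵇ E))) z₀ := by
    have hind := FiberBundle.Prod.isInducing_diag Unit E Unit E
    rw [hind.continuousAt_iff]
    exact hf.prodMk hg
  exact hE.continuous_add.continuousAt.comp h

theorem continuousAt_smul {Z : Type*} [TopologicalSpace Z] {b : Z → X} {c : Z → 𝕂}
    {f : ∀ z, E (b z)} {z₀ : Z} (hc : ContinuousAt c z₀)
    (hf : ContinuousAt (fun z => (⟨b z, f z⟩ : Tot E)) z₀) :
    ContinuousAt (fun z => (⟨b z, c z • f z⟩ : Tot E)) z₀ :=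
  (hE.continuous_smul.continuousAt (x := (c z₀, ⟨b z₀, f z₀⟩))).comp
    (f := fun z => (c z, (⟨b z, f z⟩ : Tot E))) (hc.prodMk hf)

theorem continuousAt_sub {Z : Type*} [TopologicalSpace Z] {b : Z → X} {f g : ∀ z, E (b z)} {z₀ : Z}
    (hf : ContinuousAt (fun z => (⟨b z, f z⟩ : Tot E)) z₀)
    (hg : ContinuousAt (fun z => (⟨b z, g z⟩ : Tot E)) z₀) :
    ContinuousAt (fun z => (⟨b z, f z - g z⟩ : Tot E)) z₀ := by
  have := hE.continuousAt_add hf (hE.continuousAt_smul (c := fun _ => (-1 : 𝕂))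
    continuousAt_const hg)
  simpa [sub_eq_add_neg] using this

theorem continuousAt_sum {Z : Type*} [TopologicalSpace Z] {b : Z → X} {z₀ : Z}
    (hb : ContinuousAt b z₀) {ι : Type*} (t : Finset ι) {f : ι → ∀ z, E (b z)}
    (hf : ∀ i ∈ t, ContinuousAt (fun z => (⟨b z, f i z⟩ : Tot E)) z₀) :
    ContinuousAt (fun z => (⟨b z, ∑ i ∈ t, f i z⟩ : Tot E)) z₀ := by
  classical
  induction t using Finset.induction_on with
  | empty =>
    simp only [Finset.sum_empty]
    exact (hE.continuous_zero.continuousAt (x := b z₀)).comp (f := b) hb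
  | insert i t hi ih =>
    simp only [Finset.sum_insert hi]
    exact hE.continuousAt_add (hf i (Finset.mem_insert_self i t))
      (ih fun j hj => hf j (Finset.mem_insert_of_mem hj))

end IsBanachBundle

variable {n : ℕ}

/-- In a weakly full homogeneous bundle there are local sections which form a basis at a given
point. -/
theorem exists_sections_linearIndependent (hn : IsHomogeneous 𝕂 E n) (hfull : IsWeaklyFull E)
    (x₀ : X) : ∃ s : Fin n → ∀ y, E y,
      (∀ i, ContinuousAt (fun y => (⟨y, s i y⟩ : Tot E)) x₀) ∧
      LinearIndependent 𝕂 fun i => s i x₀ := by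
  obtain ⟨hfd, hfr⟩ := hn x₀
  have : CompleteSpace (E x₀) := FiniteDimensional.complete 𝕂 (E x₀)
  set b := Module.finBasisOfFinrankEq 𝕂 (E x₀) hfr
  -- Linear independence is an open condition, so approximating a basis by values of sections is
  -- enough.
  have hopen := isOpen_setOfPred_linearIndependent (𝕜 := 𝕂) (E := E x₀) (ι := Fin n)
  obtain ⟨ε, hε, hball⟩ := Metric.isOpen_iff.1 hopen (fun i => b i) b.linearIndependent
  choose U hU s hs hsb using fun i => hfull x₀ (b i) ε hε
  refine ⟨s, fun i => (hs i).continuousAt (hU i), hball ?_⟩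
  rw [Metric.mem_ball, dist_pi_lt_iff hε]
  intro i
  rw [dist_eq_norm]
  exact hsb i

/-- Local sections which form a basis at `x₀` are uniformly independent near `x₀`. -/
theorem IsFBanachBundle.exists_norm_le (hE : IsFBanachBundle 𝕂 E) {x₀ : X}
    {s : Fin n → ∀ y, E y} (hs : ∀ i, ContinuousAt (fun y => (⟨y, s i y⟩ : Tot E)) x₀)
    (hli : LinearIndependent 𝕂 fun i => s i x₀) :
    ∃ c > 0, ∀ᶠ y in 𝓝 x₀, ∀ h : Euc 𝕂 n, c * ‖h‖ ≤ ‖∑ i, h i • s i y‖ := by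
  have hc : ∀ h₀ : Euc 𝕂 n, ContinuousAt
      (fun z : X × Euc 𝕂 n => ‖∑ i, z.2 i • s i z.1‖) (x₀, h₀) := by
    intro h₀
    have h1 : ContinuousAt (fun z : X × Euc 𝕂 n => (⟨z.1, ∑ i, z.2 i • s i z.1⟩ : Tot E))
        (x₀, h₀) := by
      refine hE.continuousAt_sum continuousAt_fst _ fun i _ => hE.continuousAt_smul ?_ ?_
      · fun_prop
      · exact ContinuousAt.comp (f := fun z : X × Euc 𝕂 n => z.1) (x := (x₀, h₀)) (hs i)
          continuousAt_fst
    exact (hE.continuous_norm.continuousAt (x := ⟨x₀, ∑ i, h₀ i • s i x₀⟩)).comp h1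
  have hcomp : IsCompact (Metric.sphere (0 : Euc 𝕂 n) 1) := isCompact_sphere _ _
  have hpos : ∀ h ∈ Metric.sphere (0 : Euc 𝕂 n) 1, 0 < ‖∑ i, h i • s i x₀‖ := by
    intro h hh
    rw [norm_pos_iff]
    intro h0
    have h2 := Fintype.linearIndependent_iff.1 hli (fun i => h i) h0
    have h3 : h = 0 := by
      ext i
      exact h2 i
    simp [h3] at hh
  obtain ⟨c, hc0, hcle⟩ : ∃ c > 0, ∀ h ∈ Metric.sphere (0 : Euc 𝕂 n) 1,
      c < ‖∑ i, h i • s i x₀‖ := by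
    -- The sphere is empty when `n = 0`.
    rcases (Metric.sphere (0 : Euc 𝕂 n) 1).eq_empty_or_nonempty with he | hne
    · exact ⟨1, one_pos, by simp [he]⟩
    · have hcont : Continuous fun h : Euc 𝕂 n => ‖∑ i, h i • s i x₀‖ := by fun_prop
      obtain ⟨h, hh, hmin⟩ := hcomp.exists_isMinOn hne hcont.continuousOn
      exact ⟨‖∑ i, h i • s i x₀‖ / 2, half_pos (hpos h hh), fun h' hh' =>
        (half_lt_self (hpos h hh)).trans_le (hmin hh')⟩
  refine ⟨c, hc0, ?_⟩
  -- Joint continuity and compactness of the sphere make the bound uniform in `h` for `y` near `x₀`;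
  -- homogeneity extends it to all `h`.
  have hev := hcomp.eventually_forall_of_forall_eventually (x₀ := x₀)
    (P := fun y h => c < ‖∑ i, h i • s i y‖)
    fun h hh => (hc h).eventually (lt_mem_nhds (hcle h hh))
  filter_upwards [hev] with y hy h
  rcases eq_or_ne h 0 with rfl | h0
  · simp
  · have hh : 0 < ‖h‖ := norm_pos_iff.2 h0
    have hunit := hy (((‖h‖⁻¹ : ℝ) : 𝕂) • h) (by
      rw [mem_sphere_zero_iff_norm, norm_smul, RCLike.norm_ofReal, abs_of_pos (inv_pos.2 hh),
        inv_mul_cancel₀ hh.ne'])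
    simp only [PiLp.smul_apply, smul_assoc] at hunit
    rw [← Finset.smul_sum, norm_smul, RCLike.norm_ofReal, abs_of_pos (inv_pos.2 hh),
      lt_inv_mul_iff₀ hh] at hunit
    rw [mul_comm]
    exact hunit.le

/-- Weakly full homogeneous (F) Banach bundles are locally trivial. -/
theorem IsFBanachBundle.exists_frame (hE : IsFBanachBundle 𝕂 E) (hn : IsHomogeneous 𝕂 E n)
    (hfull : IsWeaklyFull E) (x₀ : X) :
    ∃ φ : ∀ y, Euc 𝕂 n ≃L[𝕂] E y,
      (∀ h₀, ContinuousAt (fun z : X × Euc 𝕂 n => (⟨z.1, φ z.1 z.2⟩ : Tot E)) (x₀, h₀)) ∧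
      ∀ v₀ : E x₀, ContinuousAt (fun p : Tot E => (φ p.proj).symm p.snd) ⟨x₀, v₀⟩ := by
  classical
  obtain ⟨s, hs, hli⟩ := exists_sections_linearIndependent hn hfull x₀
  obtain ⟨c, hc, hev⟩ := hE.exists_norm_le hs hli
  -- Where the lower bound holds, the sections are independent and hence a basis by dimension;
  -- elsewhere any isomorphism serves as a default.
  have hex : ∀ y, ∃ φ : Euc 𝕂 n ≃L[𝕂] E y,
      (∀ h : Euc 𝕂 n, c * ‖h‖ ≤ ‖∑ i, h i • s i y‖) → ∀ h, φ h = ∑ i, h i • s i y := by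
    intro y
    obtain ⟨hfd, hfr⟩ := hn y
    have hfr' : Module.finrank 𝕂 (Euc 𝕂 n) = Module.finrank 𝕂 (E y) := by
      rw [hfr, finrank_euclideanSpace_fin]
    by_cases hy : ∀ h : Euc 𝕂 n, c * ‖h‖ ≤ ‖∑ i, h i • s i y‖
    · set f : Euc 𝕂 n →ₗ[𝕂] E y :=
        ∑ i, (EuclideanSpace.proj i : Euc 𝕂 n →L[𝕂] 𝕂).toLinearMap.smulRight (s i y) with hf
      have hfa : ∀ h, f h = ∑ i, h i • s i y := fun h => by simp [hf]
      have hinj : Function.Injective f := by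
        rw [← LinearMap.ker_eq_bot, LinearMap.ker_eq_bot']
        intro h hh
        have := hy h
        rw [← hfa, hh, norm_zero] at this
        exact norm_le_zero_iff.1 (nonpos_of_mul_nonpos_right this hc)
      exact ⟨(LinearEquiv.ofInjectiveOfFinrankEq f hinj hfr').toContinuousLinearEquiv,
        fun _ h => hfa h⟩
    · exact ⟨ContinuousLinearEquiv.ofFinrankEq hfr', fun h => absurd h hy⟩
  choose φ hφ using hex
  have hφev : ∀ᶠ y in 𝓝 x₀, ∀ h, φ y h = ∑ i, h i • s i y :=
    hev.mono fun y hy => hφ y hy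
  have hcont : ∀ h₀, ContinuousAt
      (fun z : X × Euc 𝕂 n => (⟨z.1, φ z.1 z.2⟩ : Tot E)) (x₀, h₀) := by
    intro h₀
    have h1 : ContinuousAt (fun z : X × Euc 𝕂 n => (⟨z.1, ∑ i, z.2 i • s i z.1⟩ : Tot E))
        (x₀, h₀) := by
      refine hE.continuousAt_sum continuousAt_fst _ fun i _ => hE.continuousAt_smul ?_ ?_
      · fun_prop
      · exact ContinuousAt.comp (f := fun z : X × Euc 𝕂 n => z.1) (x := (x₀, h₀)) (hs i)
          continuousAt_fst
    refine h1.congr ?_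
    filter_upwards [continuousAt_fst.eventually hφev] with z hz
    rw [hz]
  refine ⟨φ, hcont, fun v₀ => ?_⟩
  set h₀ := (φ x₀).symm v₀ with hh₀
  have hproj : ContinuousAt (fun p : Tot E => p.proj) ⟨x₀, v₀⟩ := hE.continuous_proj.continuousAt
  have hsec : ContinuousAt (fun p : Tot E => (⟨p.proj, φ p.proj h₀⟩ : Tot E)) ⟨x₀, v₀⟩ :=
    (hcont h₀).comp (f := fun p : Tot E => (p.proj, h₀)) (x := ⟨x₀, v₀⟩)
      (hproj.prodMk continuousAt_const)
  have hid : ContinuousAt (fun p : Tot E => (⟨p.proj, p.snd⟩ : Tot E)) ⟨x₀, v₀⟩ := continuousAt_id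
  have hdiff := (hE.continuous_norm.continuousAt).comp (hE.continuousAt_sub hid hsec)
  -- The lower bound dominates the distance of the coordinates of `p` from `h₀` by this quantity,
  -- which tends to `0` because the norm is continuous.
  have hlim : Tendsto (fun p : Tot E => c⁻¹ * ‖p.snd - φ p.proj h₀‖) (𝓝 ⟨x₀, v₀⟩) (𝓝 0) := by
    have h1 : Tendsto (fun p : Tot E => ‖p.snd - φ p.proj h₀‖) (𝓝 ⟨x₀, v₀⟩)
        (𝓝 ‖v₀ - φ x₀ h₀‖) := hdiff
    have h2 := h1.const_mul c⁻¹
    rwa [hh₀, ContinuousLinearEquiv.apply_symm_apply, sub_self, norm_zero, mul_zero] at h2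
  rw [ContinuousAt, tendsto_iff_norm_sub_tendsto_zero]
  refine squeeze_zero' (Eventually.of_forall fun _ => norm_nonneg _) ?_ hlim
  filter_upwards [hproj.eventually hev, hproj.eventually hφev] with p hp hp'
  rw [← hh₀, le_inv_mul_iff₀ hc]
  refine (hp _).trans (le_of_eq ?_)
  rw [← hp', map_sub, ContinuousLinearEquiv.apply_symm_apply]

end Bundle

/-! ### Vertical bodies in the model fibre -/

section Model

variable {X : Type*} {E : X → Type*} [∀ x, NormedAddCommGroup (E x)] [∀ x, NormedSpace ℝ (E x)]
  {𝕂 : Type*} [RCLike 𝕂] [∀ x, NormedSpace 𝕂 (E x)] {d : ℕ}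

/-- A vertical body, moved to the model fibre by a frame. -/
def VerticalBody.model (φ : ∀ y, Euc 𝕂 d ≃L[𝕂] E y) (K : VerticalBody E) : Set (Euc 𝕂 d) :=
  φ K.base ⁻¹' (K.body.1 : Set (E K.base))

theorem VerticalBody.isCompact_model (φ : ∀ y, Euc 𝕂 d ≃L[𝕂] E y) (K : VerticalBody E) :
    IsCompact (K.model φ) :=
  (φ K.base).toHomeomorph.isCompact_preimage.2 K.body.1.isCompact

end Model

/-! ### The Vietoris topology in a frame -/

section Vietoris

variable {X : Type*} {E : X → Type*}
  [∀ x, NormedAddCommGroup (E x)] [∀ x, NormedSpace ℝ (E x)] [TopologicalSpace (Tot E)]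

theorem VerticalBody.eventually_subset {K₀ : VerticalBody E} {O : Set (Tot E)} (hO : IsOpen O)
    (h : K₀.toSet ⊆ O) : ∀ᶠ K in 𝓝 K₀, K.toSet ⊆ O := by
  let _ := TopologicalSpace.vietoris (Tot E)
  have hc : Continuous (VerticalBody.toSet : VerticalBody E → Set (Tot E)) := continuous_induced_dom
  exact (hO.powerset_vietoris.preimage hc).mem_nhds h

theorem VerticalBody.eventually_inter_nonempty {K₀ : VerticalBody E} {O : Set (Tot E)}
    (hO : IsOpen O) (h : (K₀.toSet ∩ O).Nonempty) : ∀ᶠ K in 𝓝 K₀, (K.toSet ∩ O).Nonempty := by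
  let _ := TopologicalSpace.vietoris (Tot E)
  have hc : Continuous (VerticalBody.toSet : VerticalBody E → Set (Tot E)) := continuous_induced_dom
  exact ((TopologicalSpace.vietoris.isOpen_inter_nonempty_of_isOpen hO).preimage hc).mem_nhds h

theorem VerticalBody.tendsto_nhds {ι : Type*} {l : Filter ι} {f : ι → VerticalBody E}
    {K₀ : VerticalBody E}
    (hsub : ∀ O : Set (Tot E), IsOpen O → K₀.toSet ⊆ O → ∀ᶠ i in l, (f i).toSet ⊆ O)
    (hint : ∀ O : Set (Tot E), IsOpen O → (K₀.toSet ∩ O).Nonempty →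
      ∀ᶠ i in l, ((f i).toSet ∩ O).Nonempty) : Tendsto f l (𝓝 K₀) := by
  let _ := TopologicalSpace.vietoris (Tot E)
  rw [nhds_induced, tendsto_comap_iff, TopologicalSpace.tendsto_nhds_generateFrom_iff]
  rintro _ (⟨O, hO, rfl⟩ | ⟨O, hO, rfl⟩) hmem
  · exact hsub O hO hmem
  · exact hint O hO hmem

variable {𝕂 : Type*} [RCLike 𝕂] [∀ x, NormedSpace 𝕂 (E x)] {d : ℕ}

/-- Vietoris convergence implies convergence in the model fibre. -/
theorem VerticalBody.eventually_near {φ : ∀ y, Euc 𝕂 d ≃L[𝕂] E y} {K₀ : VerticalBody E}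
    (hφ : ∀ v₀ : E K₀.base, ContinuousAt (fun p : Tot E => (φ p.proj).symm p.snd) ⟨K₀.base, v₀⟩)
    {ε : ℝ} (hε : 0 < ε) : ∀ᶠ K in 𝓝 K₀, Near ε (K.model φ) (K₀.model φ) := by
  have h1 : ∀ᶠ K in 𝓝 K₀, K.model φ ⊆ Metric.thickening ε (K₀.model φ) := by
    -- The coordinate map is continuous only at points over the base of `K₀`, so preimages of open
    -- sets are replaced by their interiors.
    have hO := VerticalBody.eventually_subset (K₀ := K₀) (isOpen_interior
      (s := (fun p : Tot E => (φ p.proj).symm p.snd) ⁻¹' Metric.thickening ε (K₀.model φ))) (by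
        rintro _ ⟨v, hv, rfl⟩
        rw [mem_interior_iff_mem_nhds]
        refine (hφ v).preimage_mem_nhds (Metric.isOpen_thickening.mem_nhds
          (Metric.self_subset_thickening hε _ ?_))
        simpa [VerticalBody.model] using hv)
    filter_upwards [hO] with K hK h hh
    have := interior_subset (hK (mem_image_of_mem _ hh))
    simpa using this
  have h2 : ∀ᶠ K in 𝓝 K₀, K₀.model φ ⊆ Metric.thickening ε (K.model φ) := by
    -- Only finitely many hitting conditions are available at once; meeting the balls around a
    -- finite `ε / 2`-net is enough.
    obtain ⟨t, ht, hcov⟩ := (K₀.isCompact_model φ).elim_nhds_subcover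
      (fun h => Metric.ball h (ε / 2)) fun h _ => Metric.ball_mem_nhds h (half_pos hε)
    have hev : ∀ᶠ K in 𝓝 K₀, ∀ h ∈ t, (K.model φ ∩ Metric.ball h (ε / 2)).Nonempty := by
      rw [Filter.eventually_all_finset]
      intro h hh
      have hO := VerticalBody.eventually_inter_nonempty (K₀ := K₀) (isOpen_interior
        (s := (fun p : Tot E => (φ p.proj).symm p.snd) ⁻¹' Metric.ball h (ε / 2)))
        ⟨⟨K₀.base, φ K₀.base h⟩, mem_image_of_mem _ (ht h hh), by
          rw [mem_interior_iff_mem_nhds]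
          exact (hφ _).preimage_mem_nhds (Metric.isOpen_ball.mem_nhds (by simpa using hε))⟩
      filter_upwards [hO] with K hK
      obtain ⟨_, ⟨v, hv, rfl⟩, hv'⟩ := hK
      have hball := interior_subset hv'
      exact ⟨(φ K.base).symm v, by simpa [VerticalBody.model] using hv, hball⟩
    filter_upwards [hev] with K hK x hx
    obtain ⟨h, hh, hxh⟩ := mem_iUnion₂.1 (hcov hx)
    obtain ⟨y, hy, hyh⟩ := hK h hh
    refine Metric.mem_thickening_iff.2 ⟨y, hy, ?_⟩
    rw [Metric.mem_ball] at hxh hyh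
    linarith [dist_triangle_right x y h]
  filter_upwards [h1, h2] with K hK hK'
  exact ⟨hK, hK'⟩

variable [TopologicalSpace X]

theorem VerticalBody.tendsto_base
    (hproj : Continuous fun p : Tot E => p.proj) (K₀ : VerticalBody E) :
    Tendsto VerticalBody.base (𝓝 K₀) (𝓝 K₀.base) := by
  rw [_root_.tendsto_nhds]
  intro U hU hmem
  filter_upwards [VerticalBody.eventually_subset (hU.preimage hproj) (K₀ := K₀) (by
    rintro _ ⟨v, -, rfl⟩
    exact hmem)] with K hK
  obtain ⟨v, hv⟩ := K.body.1.nonempty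
  exact hK (mem_image_of_mem _ hv)

/-- Convergence in the base and in the model fibre implies Vietoris convergence. -/
theorem VerticalBody.tendsto_of_near {φ : ∀ y, Euc 𝕂 d ≃L[𝕂] E y} {K₀ : VerticalBody E}
    (hφ : ∀ h₀, ContinuousAt (fun z : X × Euc 𝕂 d => (⟨z.1, φ z.1 z.2⟩ : Tot E)) (K₀.base, h₀))
    {ι : Type*} {l : Filter ι} {f : ι → VerticalBody E}
    (hbase : Tendsto (fun i => (f i).base) l (𝓝 K₀.base))
    (hnear : ∀ ε > 0, ∀ᶠ i in l, Near ε ((f i).model φ) (K₀.model φ)) : Tendsto f l (𝓝 K₀) := by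
  apply VerticalBody.tendsto_nhds
  · intro O hO hsub
    -- The displacement `z.2` from a point `h` of the model body is a second parameter, so one `ε`
    -- works for the whole compact body.
    have hev := (K₀.isCompact_model φ).eventually_forall_of_forall_eventually
      (x₀ := ((K₀.base, 0) : X × Euc 𝕂 d))
      (P := fun z h => (⟨z.1, φ z.1 (h + z.2)⟩ : Tot E) ∈ O) (by
        intro h hh
        have hc : ContinuousAt (fun z : (X × Euc 𝕂 d) × Euc 𝕂 d =>
            (⟨z.1.1, φ z.1.1 (z.2 + z.1.2)⟩ : Tot E)) ((K₀.base, 0), h) := by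
          refine ContinuousAt.comp (f := fun z : (X × Euc 𝕂 d) × Euc 𝕂 d =>
            (z.1.1, z.2 + z.1.2)) (x := ((K₀.base, 0), h)) (hφ (h + 0)) ?_
          fun_prop
        refine hc.eventually (hO.mem_nhds (hsub ?_))
        simp only [add_zero]
        exact mem_image_of_mem _ hh)
    rw [nhds_prod_eq, eventually_prod_iff] at hev
    obtain ⟨P, hP, Q, hQ, hPQ⟩ := hev
    obtain ⟨ε, hε, hεQ⟩ := Metric.eventually_nhds_iff.1 hQ
    filter_upwards [hbase.eventually hP, hnear ε hε] with i hi hn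
    rintro _ ⟨v, hv, rfl⟩
    have hv' : (φ (f i).base).symm v ∈ (f i).model φ := by simpa [VerticalBody.model] using hv
    obtain ⟨h, hh, hdist⟩ := Metric.mem_thickening_iff.1 (hn.1 hv')
    have := hPQ hi (hεQ (y := (φ (f i).base).symm v - h) (by
      rwa [dist_zero_right, ← dist_eq_norm])) h hh
    simpa using this
  · rintro O hO ⟨_, ⟨v, hv, rfl⟩, hvO⟩
    have hev : ∀ᶠ z : X × Euc 𝕂 d in 𝓝 (K₀.base, (φ K₀.base).symm v),
        (⟨z.1, φ z.1 z.2⟩ : Tot E) ∈ O :=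
      (hφ _).eventually (hO.mem_nhds (by simpa using hvO))
    rw [nhds_prod_eq, eventually_prod_iff] at hev
    obtain ⟨P, hP, Q, hQ, hPQ⟩ := hev
    obtain ⟨ε, hε, hεQ⟩ := Metric.eventually_nhds_iff.1 hQ
    filter_upwards [hbase.eventually hP, hnear ε hε] with i hi hn
    have hv' : (φ K₀.base).symm v ∈ K₀.model φ := by simpa [VerticalBody.model] using hv
    obtain ⟨h, hh, hdist⟩ := Metric.mem_thickening_iff.1 (hn.2 hv')
    exact ⟨⟨(f i).base, φ (f i).base h⟩, mem_image_of_mem _ hh,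
      hPQ hi (hεQ (by rwa [dist_comm]))⟩

/-- Continuity of a fibrewise self-map given by the solutions of a well-posed maximization
problem, at a body for which the solution is unique. -/
theorem IsFBanachBundle.continuousAt_verticalMap [∀ x, IsScalarTower ℝ 𝕂 (E x)]
    (hE : IsFBanachBundle 𝕂 E) (hn : IsHomogeneous 𝕂 E d) (hfull : IsWeaklyFull E)
    {F : Set (Euc 𝕂 d) → Set (EllParam 𝕂 d)} (hF : IsStableConstraint F)
    {S : EllParam 𝕂 d → Set (Euc 𝕂 d)}
    (hS : ∀ q₀ : EllParam 𝕂 d, q₀.1.det ≠ 0 → ∀ ε > 0, ∀ᶠ q in 𝓝 q₀, Near ε (S q) (S q₀))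
    {g : ∀ x, SolidBody (E x) → SolidBody (E x)}
    (hg : ∀ x (φ : Euc 𝕂 d ≃L[𝕂] E x) (K : SolidBody (E x)),
      ∃ q ∈ maxDet (F (φ ⁻¹' (K.1 : Set (E x)))), ((g x K).1 : Set (E x)) = φ '' S q)
    {K₀ : VerticalBody E}
    (huniq : ∀ φ : Euc 𝕂 d ≃L[𝕂] E K₀.base,
      ∀ q₁ ∈ maxDet (F (φ ⁻¹' (K₀.body.1 : Set (E K₀.base)))),
      ∀ q₂ ∈ maxDet (F (φ ⁻¹' (K₀.body.1 : Set (E K₀.base)))), S q₁ = S q₂) :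
    ContinuousAt (verticalMap g) K₀ := by
  obtain ⟨φ, hφ, hφ'⟩ := hE.exists_frame hn hfull K₀.base
  have hmodel : ∀ K : VerticalBody E, ∃ q ∈ maxDet (F (K.model φ)),
      (verticalMap g K).model φ = S q := by
    intro K
    obtain ⟨q, hq, h⟩ := hg K.base (φ K.base) K.body
    refine ⟨q, hq, ?_⟩
    change φ K.base ⁻¹' ((g K.base K.body).1 : Set (E K.base)) = S q
    rw [h, preimage_image_eq _ (φ K.base).injective]
  refine VerticalBody.tendsto_of_near (K₀ := verticalMap g K₀) (φ := φ) hφ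
    (VerticalBody.tendsto_base hE.continuous_proj K₀) fun ε hε => ?_
  obtain ⟨δ, hδ, h⟩ := hF.exists_near hS (isSolidBody_preimage (φ K₀.base) K₀.body)
    (huniq (φ K₀.base)) hε
  obtain ⟨q₀, hq₀, hS₀⟩ := hmodel K₀
  filter_upwards [VerticalBody.eventually_near hφ' hδ] with K hK
  obtain ⟨q, hq, hSq⟩ := hmodel K
  rw [hSq, hS₀]
  exact h _ (isSolidBody_preimage (φ K.base) K.body) hK q hq q₀ hq₀

end Vietoris

/-! ### Löwner and John maps of a bundle -/

section Main

variable {𝕂 : Type*} [RCLike 𝕂] {X : Type*} [TopologicalSpace X] {E : X → Type*}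
  [∀ x, NormedAddCommGroup (E x)] [∀ x, NormedSpace 𝕂 (E x)] [TopologicalSpace (Tot E)] {n : ℕ}

theorem IsHomogeneous.nonempty_equiv {X : Type*} {E : X → Type*} [∀ x, NormedAddCommGroup (E x)]
    [∀ x, NormedSpace 𝕂 (E x)] (hn : IsHomogeneous 𝕂 E n) (x : X) :
    Nonempty (Euc 𝕂 n ≃L[𝕂] E x) := by
  obtain ⟨hfd, hfr⟩ := hn x
  exact ⟨ContinuousLinearEquiv.ofFinrankEq (by rw [hfr, finrank_euclideanSpace_fin])⟩

variable [∀ x, NormedSpace ℝ (E x)] [∀ x, IsScalarTower ℝ 𝕂 (E x)]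

theorem IsFBanachBundle.restrictScalars (hE : IsFBanachBundle 𝕂 E) : IsFBanachBundle ℝ E where
  complete := hE.complete
  continuous_proj := hE.continuous_proj
  isOpenMap_proj := hE.isOpenMap_proj
  continuous_smul := by
    have h : Continuous fun q : ℝ × Tot E => ((q.1 : 𝕂), q.2) := by fun_prop
    refine (hE.continuous_smul.comp h).congr fun q => ?_
    simp
  continuous_add := hE.continuous_add
  nhds_zero := hE.nhds_zero
  continuous_norm := hE.continuous_norm

theorem IsHomogeneous.restrictScalars {X : Type*} {E : X → Type*} [∀ x, NormedAddCommGroup (E x)]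
    [∀ x, NormedSpace 𝕂 (E x)] [∀ x, NormedSpace ℝ (E x)] [∀ x, IsScalarTower ℝ 𝕂 (E x)]
    (hn : IsHomogeneous 𝕂 E n) : IsHomogeneous ℝ E (Module.finrank ℝ 𝕂 * n) := by
  intro x
  obtain ⟨hfd, hfr⟩ := hn x
  exact ⟨Module.Finite.trans 𝕂 (E x), by rw [← hfr, Module.finrank_mul_finrank]⟩

/-- The Löwner map of a bundle. -/
theorem IsFBanachBundle.exists_loewnerMap (hE : IsFBanachBundle 𝕂 E) (hn : IsHomogeneous 𝕂 E n)
    (hfull : IsWeaklyFull E) : ∃ g : ∀ x, SolidBody (E x) → SolidBody (E x),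
      (∀ x K L, IsLoewner 𝕂 K L ↔ L = g x K) ∧ Continuous (verticalMap g) := by
  have hex : ∀ x (K : SolidBody (E x)), ∃! L, IsLoewner 𝕂 K L := fun x K =>
    existsUnique_isLoewner (hn.nonempty_equiv x).some K
  choose g hg hguniq using hex
  refine ⟨g, fun x K L => ⟨hguniq x K L, fun h => h ▸ hg x K⟩, ?_⟩
  rw [continuous_iff_continuousAt]
  intro K₀
  exact hE.continuousAt_verticalMap hn hfull isStableConstraint_outer
    (fun q₀ hq₀ ε hε => eventually_near_outerSet hq₀ hε)
    (fun x φ K => (isLoewner_iff φ K (g x K)).1 (hg x K))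
    fun φ q₁ h₁ q₂ h₂ => outerSet_eq_of_mem_maxDet (isSolidBody_preimage φ K₀.body) h₁ h₂

/-- A John map of a bundle. -/
theorem IsFBanachBundle.exists_johnMap (hE : IsFBanachBundle 𝕂 E) (hn : IsHomogeneous 𝕂 E n)
    (hfull : IsWeaklyFull E) : ∃ g : ∀ x, SolidBody (E x) → SolidBody (E x),
      (∀ x K, IsJohn 𝕂 K (g x K)) ∧ ∀ K₀ : VerticalBody E,
        (∃! J : SolidBody (E K₀.base), IsJohn 𝕂 K₀.body J) → ContinuousAt (verticalMap g) K₀ := by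
  have hex : ∀ x (K : SolidBody (E x)), ∃ J, IsJohn 𝕂 K J := fun x K =>
    exists_isJohn (hn.nonempty_equiv x).some K
  -- Any selection works: upper semicontinuity controls all maximizers over nearby bodies, so
  -- uniqueness is needed only at `K₀`.
  choose g hg using hex
  refine ⟨g, hg, fun K₀ hK₀ => ?_⟩
  exact hE.continuousAt_verticalMap hn hfull isStableConstraint_inner
    (fun q₀ _ ε hε => eventually_near_innerSet q₀ hε)
    (fun x φ K => (isJohn_iff φ K (g x K)).1 (hg x K))
    fun φ q₁ h₁ q₂ h₂ => innerSet_eq_of_existsUnique_isJohn φ hK₀ h₁ h₂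

end Main

theorem mainTheorem6 {𝕜 : Type*} [RCLike 𝕜] {X : Type*} [TopologicalSpace X]
    (E : X → Type*) [∀ x, NormedAddCommGroup (E x)] [∀ x, NormedSpace ℝ (E x)]
    [∀ x, NormedSpace 𝕜 (E x)] [∀ x, IsScalarTower ℝ 𝕜 (E x)] [TopologicalSpace (Tot E)]
    (n : ℕ) (hE : IsFBanachBundle 𝕜 E) (hn : IsHomogeneous 𝕜 E n) (hfull : IsWeaklyFull E) :
    -- Real ellipsoids: Löwner and John maps on all bodies.
    (∃ g : ∀ x, SolidBody (E x) → SolidBody (E x),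
      (∀ x K L, IsLoewner ℝ K L ↔ L = g x K) ∧ Continuous (verticalMap g)) ∧
    (∃ g : ∀ x, SolidBody (E x) → SolidBody (E x),
      (∀ x K J, IsJohn ℝ K J ↔ J = g x K) ∧ Continuous (verticalMap g)) ∧
    -- Ellipsoids over the scalar field `𝕜` of the bundle: the Löwner map on all bodies.
    (∃ g : ∀ x, SolidBody (E x) → SolidBody (E x),
      (∀ x K L, IsLoewner 𝕜 K L ↔ L = g x K) ∧ Continuous (verticalMap g)) ∧
    -- Ellipsoids over `𝕜`: the John map on all bodies whose John `𝕜`-ellipsoid is unique; the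
    -- translates of balanced bodies are among these.
    (∃ g : ∀ x, SolidBody (E x) → SolidBody (E x),
      (∀ x K, IsJohn 𝕜 K (g x K)) ∧
      ContinuousOn (verticalMap g)
        {K : VerticalBody E | ∃! J : SolidBody (E K.base), IsJohn 𝕜 K.body J} ∧
      ∀ x (K : SolidBody (E x)) (c : E x),
        Balanced 𝕜 ((fun v => v - c) '' (K.1 : Set (E x))) → ∃! J, IsJohn 𝕜 K J) := by
  -- The statements on real ellipsoids are those for the underlying real bundle, of rank `n` times
  -- the real dimension of `𝕜`.
  have hEr : IsFBanachBundle ℝ E := hE.restrictScalars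
  have hnr := hn.restrictScalars
  have hJr : ∀ x (K : SolidBody (E x)), ∃! J, IsJohn ℝ K J := fun x K =>
    existsUnique_isJohn_of_units (𝕂 := ℝ)
      (fun l hl => eq_or_eq_neg_of_abs_eq (by rwa [Real.norm_eq_abs] at hl))
      (hnr.nonempty_equiv x).some K
  refine ⟨hEr.exists_loewnerMap hnr hfull, ?_, hE.exists_loewnerMap hn hfull, ?_⟩
  · obtain ⟨g, hg, hcont⟩ := hEr.exists_johnMap hnr hfull
    refine ⟨g, fun x K J => ⟨fun h => (hJr x K).unique h (hg x K), fun h => h ▸ hg x K⟩, ?_⟩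
    exact continuous_iff_continuousAt.2 fun K₀ => hcont K₀ (hJr K₀.base K₀.body)
  · obtain ⟨g, hg, hcont⟩ := hE.exists_johnMap hn hfull
    exact ⟨g, hg, fun K₀ hK₀ => (hcont K₀ hK₀).continuousWithinAt,
      fun x K c hc => existsUnique_isJohn_of_balanced (hn.nonempty_equiv x).some K hc⟩
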